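/- Let $1\le p<n$ be integers. For a convex body (non-empty compact convex set) $K\subset\mathbb{R}^n$ let $h_K:\mathbb{S}^{n-1}\to\mathbb{R}$, $h_K(u)=\max_{x\in K}\langle u,x\rangle$, be its support function, and let $\kappa_m$ be the volume of the unit ball of $\mathbb{R}^m$. Call $K$ \emph{normalized} if its Steiner point $\kappa_n^{-1}\int_{\mathbb{S}^{n-1}}h_K(u)\,u\,du$ is $0$ and $V_1(K)=\kappa_{n-1}^{-1}\int_{\mathbb{S}^{n-1}}h_K(u)\,du=1$. Let $\mathcal{K}^{n*}_{SV_1}$ be the set of normalized convex bodies that are neither points nor segments. For $K,L\in\mathcal{K}^{n*}_{SV_1}$ put $$d(K,L)=\operatorname{argch}\frac{V_2(K,L)}{\sqrt{V_2(K,K)V_2(L,L)}},\qquad V_2(K,L)=\frac{n-1}{2\kappa_{n-2}}\int_{\mathbb{S}^{n-1}}\Big(h_Kh_L-\frac{1}{n-1}\langle\nabla h_K,\nabla h_L\rangle\Big),$$ where $\nabla$ is the gradient of the round sphere. A \emph{shortest path} is the image of a closed bounded interval under a distance-preserving map into $(\mathcal{K}^{n*}_{SV_1},d)$. For every $K\in\mathcal{K}^{n*}_{SV_1}$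 there is an embedded $p$-dimensional ball $B\subset\mathbb{R}^n$, that is, the image of the closed ball of $\mathbb{R}^p$ with centre $0$ and radius $\kappa_{p-1}/(p\kappa_p)$ under a linear isometric embedding $\mathbb{R}^p\to\mathbb{R}^n$, such that: 1. For every $s\in[0,1]$ the body $(1-s)K+sB$ is normalized, and it is neither a point nor a segment if $s<1$ or $p\ge 2$ (for $p=1$ the starting point $B$ is itself a segment). 2. $K$ is a terminal point of the segment from $B$ to $K$: for every $t<0$ the function $(1-t)h_K+t\,h_B$ is not the support function of a normalized convex body. In fact it is not the support function of any convex body. 3. Consequently, for every $s\in(0,1]$ such that $L=(1-s)K+sB$ is not a segment, the set $\{(1-r)K+rB:\ 0\le r\le s\}$ is a shortest path from $L$ to $K$ that is not extendable beyond $K$: every shortest path containing it has $K$ as an endpoint. In particular every element of $\mathcal{K}^{n*}_{SV_1}$ is the endpoint of a shortest path that is not extendable beyond it. -/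

import Mathlib

open scoped Pointwise

noncomputable section

namespace AreaMetric

/-- Euclidean space `ℝⁿ`. -/
abbrev E (n : ℕ) : Type := EuclideanSpace ℝ (Fin n)

/-- The unit sphere `𝕊ⁿ⁻¹` of `ℝⁿ`. -/
abbrev S (n : ℕ) : Type := Metric.sphere (0 : E n) 1

/-- The surface measure of the round sphere `𝕊ⁿ⁻¹`. -/
abbrev surf (n : ℕ) : MeasureTheory.Measure (S n) :=
  (MeasureTheory.volume : MeasureTheory.Measure (E n)).toSphere

/-- The volume `κ m` of the closed unit ball of `ℝᵐ` (so `κ 0 = 1` and `κ 1 = 2`). -/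
def kappa (m : ℕ) : ℝ :=
  (MeasureTheory.volume : MeasureTheory.Measure (E m)).real (Metric.closedBall 0 1)

/-- The support function `u ↦ max_{x ∈ K} ⟨u, x⟩` of a convex body, on the unit sphere. -/
def supp {n : ℕ} (K : ConvexBody (E n)) (u : S n) : ℝ :=
  sSup ((fun x : E n => inner ℝ (u : E n) x) '' (K : Set (E n)))

/-- The linear functional `h ↦ κ_{n-1}⁻¹ ∫ h` over the sphere.  On the support function of a convex
body it is the first intrinsic volume (half the mean width, times `n κ_n / κ_{n-1}`). -/
def V1 (n : ℕ) (h : S n → ℝ) : ℝ :=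
  (kappa (n - 1))⁻¹ * ∫ u, h u ∂(surf n)

/-- The Steiner point of a convex body. -/
def steinerPoint {n : ℕ} (K : ConvexBody (E n)) : E n :=
  (kappa n)⁻¹ • ∫ u, supp K u • (u : E n) ∂(surf n)

open Classical in
/-- The extension of a function on the sphere to `ℝⁿ ∖ {0}` that is constant along rays
(with value `0` at the origin). -/
def radialExt {n : ℕ} (h : S n → ℝ) (y : E n) : ℝ :=
  if hy : y = 0 then 0 else h ⟨‖y‖⁻¹ • y, by simp [norm_smul, hy]⟩

/-- The gradient on the round sphere: the Euclidean gradient of the extension that is constant along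
rays.  For Lipschitz functions, such as support functions, it exists almost everywhere and is the
weak gradient. -/
def sphGrad {n : ℕ} (h : S n → ℝ) (u : S n) : E n :=
  gradient (radialExt h) (u : E n)

/-- The bilinear form
`V₂(h, k) = c_n (∫ h k - (n - 1)⁻¹ ∫ ⟨∇h, ∇k⟩)` with `c_n = (n - 1) / (2 κ_{n-2})`.
On support functions it is the intrinsic mixed-area. -/
def V2 (n : ℕ) (h k : S n → ℝ) : ℝ :=
  ((n : ℝ) - 1) / (2 * kappa (n - 2)) *
    ((∫ u, h u * k u ∂(surf n))
      - ((n : ℝ) - 1)⁻¹ * ∫ u, inner ℝ (sphGrad h u) (sphGrad k u) ∂(surf n))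

/-- Normalized convex bodies: Steiner point at the origin, and `V₁ = 1`. -/
def IsNormalized {n : ℕ} (K : ConvexBody (E n)) : Prop :=
  steinerPoint K = 0 ∧ V1 n (supp K) = 1

/-- The convex body is a point or a segment (`segment ℝ a a` is a point). -/
def IsPointOrSegment {n : ℕ} (K : ConvexBody (E n)) : Prop :=
  ∃ a b : E n, (K : Set (E n)) = segment ℝ a b

/-- The space of normalized convex bodies of `ℝⁿ` that are neither points nor segments. -/
def NormBody (n : ℕ) : Type :=
  {K : ConvexBody (E n) // IsNormalized K ∧ ¬ IsPointOrSegment K}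

/-- The area metric `argch (V₂(K, L) / √(V₂(K) V₂(L)))`. -/
def areaDist {n : ℕ} (K L : NormBody n) : ℝ :=
  Real.arcosh (V2 n (supp K.1) (supp L.1) /
    Real.sqrt (V2 n (supp K.1) (supp K.1) * V2 n (supp L.1) (supp L.1)))

/-- The convex combination `(1 - s) K + s L` of convex bodies, for the Minkowski addition. -/
def comb {n : ℕ} (K L : ConvexBody (E n)) (s : ℝ) : ConvexBody (E n) :=
  (1 - s) • K + s • L

/-- The convex body is the image of the `p`-dimensional ball of radius
`r₁(p) = κ_{p-1} / (p κ_p)` and centre `0` under a linear isometric embedding `ℝᵖ → ℝⁿ`. -/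
def IsEmbeddedBall {n : ℕ} (p : ℕ) (B : ConvexBody (E n)) : Prop :=
  ∃ i : E p →ₗᵢ[ℝ] E n,
    (B : Set (E n)) = i '' Metric.closedBall 0 (kappa (p - 1) / (p * kappa p))

/-- `K` is a terminal point of the segment between the normalized bodies `K` and `L`: no extension
of the segment beyond `K` consists of support functions of normalized convex bodies. -/
def IsTerminalPoint {n : ℕ} (K L : ConvexBody (E n)) : Prop :=
  ∀ t : ℝ, t < 0 →
    ¬ ∃ M : ConvexBody (E n), IsNormalized M ∧
      ∀ u : S n, supp M u = (1 - t) * supp K u + t * supp L u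

/-- `P` is (the image of) a shortest path from `a` to `b` for the distance `d`, that is, it can be
parametrized by arc length on `[0, ℓ]` so that distances are preserved. -/
def IsShortestPath {X : Type*} (d : X → X → ℝ) (P : Set X) (a b : X) : Prop :=
  ∃ (l : ℝ) (c : ℝ → X), 0 ≤ l ∧
    (∀ s ∈ Set.Icc 0 l, ∀ t ∈ Set.Icc 0 l, d (c s) (c t) = |s - t|) ∧
    c 0 = a ∧ c l = b ∧ c '' Set.Icc 0 l = P

/-- The shortest path `P`, one of whose endpoints is `b`, is not extendable beyond `b`: every
shortest path that contains `P` also has `b` as an endpoint. -/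
def NotExtendableBeyond {X : Type*} (d : X → X → ℝ) (P : Set X) (b : X) : Prop :=
  ∀ (Q : Set X) (x y : X), IsShortestPath d Q x y → P ⊆ Q → b = x ∨ b = y

end AreaMetric

end

open AreaMetric

section

open MeasureTheory ProbabilityTheory Filter Topology Real

namespace AreaMetric

set_option linter.unusedSectionVars false

/-! ### Gaussian integrals in polar coordinates. -/

section Gaussian

variable {V : Type*} [NormedAddCommGroup V] [InnerProductSpace ℝ V] [FiniteDimensional ℝ V]
  [MeasurableSpace V] [BorelSpace V]

/-! The problem is moved from the sphere to Gaussian space. For Lipschitz functions that are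
positively homogeneous of degree one, polar coordinates turn `V2` into a fixed positive multiple of
`gaussForm f g` = E(fg) − E⟨∇f, ∇g⟩ (`V2_eq_gaussForm`). Likewise `V1` becomes √(2π) times the
Gaussian mean, and the Steiner point vanishes exactly when f is uncorrelated with all linear
functions.

This form is Lorentzian. If f has mean zero and is uncorrelated with linear functions, then a
nonnegative value of the form forces f = 0 (`eq_zero_of_energy_le`); the proof compares E f(X) f(cos
θ X + sin θ Y) with a multiple of cos θ. In the other direction the form is nonnegative on a
nonnegative function paired with a sublinear one (`gaussForm_nonneg`). Comparing a body with an
ellipse inside one of its triangles then makes the form positive on every body that is neither a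
point nor a segment (`gaussForm_suppExt_pos`). So normalized bodies lie in an affine slice of the
timelike cone, and `areaDist` is the hyperbolic angle. Angles add along affine segments
(`IsTimelike.hypAngle_add`), and equality in the triangle inequality with positive summands puts the
middle function strictly inside the segment (`IsTimelike.exists_between`).

The ball is chosen as follows. The support function of K is Lipschitz, hence differentiable at some
v ≠ 0. Since p < n, the ball B fits into the hyperplane orthogonal to v, and its support function
then has a kink at v: along a unit direction in the span of B it equals r|ε|. For t < 0 the function
(1−t)h_K + t h_B has a downward kink at v, which contradicts subadditivity
(`not_suppExt_extrapolation`). If a shortest path passed through K beyond the segment from L, then K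
would lie strictly between L and some body M, and the support function of M would be such an
extrapolation. -/

/-- The density of the standard Gaussian measure, as a function of the norm. -/
noncomputable def gaussDensity (d : ℕ) (r : ℝ) : ℝ :=
  (2 * π) ^ (-(d : ℝ) / 2) * rexp (-(1 / 2) * r ^ 2)

lemma gaussDensity_pos (d : ℕ) (r : ℝ) : 0 < gaussDensity d r := by
  unfold gaussDensity; positivity

lemma continuous_gaussDensity (d : ℕ) : Continuous (gaussDensity d) := by
  unfold gaussDensity; fun_prop

lemma integral_gaussDensity :
    ∫ x : V, gaussDensity (Module.finrank ℝ V) ‖x‖ = 1 := by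
  unfold gaussDensity
  rw [integral_const_mul, GaussianFourier.integral_rexp_neg_mul_sq_norm (by norm_num),
    show π / (1 / 2 : ℝ) = 2 * π by ring, ← Real.rpow_add (by positivity)]
  simp [neg_div]

lemma integrable_gaussDensity :
    Integrable (fun x : V => gaussDensity (Module.finrank ℝ V) ‖x‖) :=
  Integrable.of_integral_ne_zero (by rw [integral_gaussDensity]; norm_num)

variable (V) in
-- Both measures are finite and have the same characteristic function.
theorem stdGaussian_eq_withDensity :
    stdGaussian V = (volume : Measure V).withDensity
      (fun x => ENNReal.ofReal (gaussDensity (Module.finrank ℝ V) ‖x‖)) := by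
  have : IsFiniteMeasure ((volume : Measure V).withDensity
      (fun x => ENNReal.ofReal (gaussDensity (Module.finrank ℝ V) ‖x‖))) :=
    isFiniteMeasure_withDensity_ofReal integrable_gaussDensity.2
  have hc := continuous_gaussDensity (Module.finrank ℝ V)
  apply Measure.ext_of_charFun
  ext t
  rw [charFun_stdGaussian, charFun_apply,
    integral_withDensity_eq_integral_toReal_smul (by fun_prop) (by simp)]
  have key := GaussianFourier.integral_cexp_neg_mul_sq_norm_add (V := V) (b := (1 / 2 : ℂ))
    (by norm_num) Complex.I t
  have hπ : (0 : ℝ) < 2 * π := by positivity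
  have h1 : ∀ x : V, (ENNReal.ofReal (gaussDensity (Module.finrank ℝ V) ‖x‖)).toReal •
      Complex.exp (inner ℝ x t * Complex.I) = (((2 * π) ^ (-(Module.finrank ℝ V : ℝ) / 2) : ℝ) : ℂ) *
        Complex.exp (-(1 / 2) * ‖x‖ ^ 2 + Complex.I * inner ℝ t x) := by
    intro x
    rw [ENNReal.toReal_ofReal (gaussDensity_pos _ _).le, gaussDensity, Complex.real_smul,
      Complex.exp_add, real_inner_comm]
    push_cast
    ring_nf
  simp_rw [h1]
  rw [integral_const_mul, key, ← mul_assoc]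
  have h2 : (((2 * π) ^ (-(Module.finrank ℝ V : ℝ) / 2) : ℝ) : ℂ) *
      (↑π / (1 / 2 : ℂ)) ^ (Module.finrank ℝ V / 2 : ℂ) = 1 := by
    have : (↑π / (1 / 2 : ℂ)) ^ (Module.finrank ℝ V / 2 : ℂ) =
        (((2 * π) ^ ((Module.finrank ℝ V : ℝ) / 2) : ℝ) : ℂ) := by
      rw [Complex.ofReal_cpow hπ.le]
      push_cast
      congr 1
      ring
    rw [this, ← Complex.ofReal_mul, ← Real.rpow_add hπ]
    simp [neg_div]
  rw [h2, one_mul, Complex.I_sq]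
  congr 1
  ring

lemma stdGaussian_absolutelyContinuous : stdGaussian V ≪ (volume : Measure V) := by
  rw [stdGaussian_eq_withDensity]
  exact withDensity_absolutelyContinuous _ _

lemma volume_absolutelyContinuous_stdGaussian : (volume : Measure V) ≪ stdGaussian V := by
  have hc := continuous_gaussDensity (Module.finrank ℝ V)
  rw [stdGaussian_eq_withDensity]
  refine withDensity_absolutelyContinuous' (by fun_prop) (ae_of_all _ fun x => ?_)
  simpa using gaussDensity_pos _ _

/-- Lets a continuous function that vanishes almost everywhere be recognized as zero everywhere. -/
instance : (stdGaussian V).IsOpenPosMeasure :=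
  volume_absolutelyContinuous_stdGaussian.isOpenPosMeasure

lemma integral_stdGaussian {W : Type*} [NormedAddCommGroup W] [NormedSpace ℝ W] (F : V → W) :
    ∫ x, F x ∂(stdGaussian V) = ∫ x, gaussDensity (Module.finrank ℝ V) ‖x‖ • F x := by
  have hc := continuous_gaussDensity (Module.finrank ℝ V)
  rw [stdGaussian_eq_withDensity, integral_withDensity_eq_integral_toReal_smul (by fun_prop)
    (by simp)]
  refine integral_congr_ae (ae_of_all _ fun x => ?_)
  simp only
  rw [ENNReal.toReal_ofReal (gaussDensity_pos _ _).le]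

/-- The radial factor in the polar decomposition of Gaussian integrals. -/
noncomputable def radialMoment (d k : ℕ) : ℝ :=
  ∫ r in Set.Ioi (0 : ℝ), r ^ (d - 1) * (gaussDensity d r * r ^ k)

/-- The density is radial, so in polar coordinates a function homogeneous of degree k splits into a
radial and a spherical factor. -/
theorem integral_stdGaussian_homogeneous [Nontrivial V] {W : Type*} [NormedAddCommGroup W]
    [NormedSpace ℝ W] (F : V → W) (k : ℕ)
    (hF : ∀ (r : ℝ) (x : V), 0 < r → F (r • x) = r ^ k • F x) :
    ∫ x, F x ∂(stdGaussian V) = radialMoment (Module.finrank ℝ V) k •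
      ∫ u : Metric.sphere (0 : V) 1, F u ∂(volume : Measure V).toSphere := by
  set d := Module.finrank ℝ V with hd
  rw [integral_stdGaussian]
  let μ : Measure V := volume
  let G : Metric.sphere (0 : V) 1 × Set.Ioi (0 : ℝ) → W :=
    fun z => (gaussDensity d z.2 * (z.2 : ℝ) ^ k) • F z.1
  calc ∫ x, gaussDensity d ‖x‖ • F x ∂μ
      = ∫ x : ({(0)}ᶜ : Set V), gaussDensity d ‖x.1‖ • F x.1 ∂(μ.comap (↑)) := by
        rw [integral_subtype_comap (measurableSet_singleton _).compl
          fun x : V ↦ gaussDensity d ‖x‖ • F x, restrict_compl_singleton]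
    _ = ∫ x : ({(0)}ᶜ : Set V), G (homeomorphUnitSphereProd V x) ∂(μ.comap (↑)) := by
        refine integral_congr_ae (ae_of_all _ fun x => ?_)
        have hx : (0 : ℝ) < ‖x.1‖ := norm_pos_iff.2 x.2
        simp only [G, homeomorphUnitSphereProd_apply_snd_coe,
          homeomorphUnitSphereProd_apply_fst_coe]
        rw [hF _ _ (inv_pos.2 hx), smul_smul, mul_assoc, inv_pow,
          mul_inv_cancel₀ (by positivity), mul_one]
    _ = ∫ z, G z ∂μ.toSphere.prod (.volumeIoiPow (d - 1)) :=
        μ.measurePreserving_homeomorphUnitSphereProd.integral_comp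
          (Homeomorph.measurableEmbedding _) G
    _ = ∫ z, G z.swap ∂((Measure.volumeIoiPow (d - 1)).prod μ.toSphere) :=
        (integral_prod_swap (μ := μ.toSphere) (ν := Measure.volumeIoiPow (d - 1)) G).symm
    _ = (∫ r : Set.Ioi (0 : ℝ), gaussDensity d r * (r : ℝ) ^ k ∂.volumeIoiPow (d - 1)) •
          ∫ u, F u ∂μ.toSphere :=
        integral_prod_smul (fun r : Set.Ioi (0 : ℝ) => gaussDensity d r * (r : ℝ) ^ k)
          (fun u : Metric.sphere (0 : V) 1 => F u)
    _ = _ := by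
      congr 1
      simp only [Measure.volumeIoiPow, ENNReal.ofReal, radialMoment]
      rw [integral_withDensity_eq_integral_smul,
        integral_subtype_comap measurableSet_Ioi fun a : ℝ ↦
          Real.toNNReal (a ^ (d - 1)) • (gaussDensity d a * a ^ k),
        setIntegral_congr_fun measurableSet_Ioi fun x hx ↦ ?_]
      · rw [NNReal.smul_def, Real.coe_toNNReal _ (pow_nonneg (le_of_lt hx) _), smul_eq_mul]
      · exact (measurable_subtype_coe.pow_const _).real_toNNReal

lemma radialMoment_eq (d k : ℕ) (hd : 1 ≤ d) :
    radialMoment d k = (2 * π) ^ (-(d : ℝ) / 2) *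
      ((1 / 2) ^ (-((d + k : ℝ) / 2)) * (1 / 2) * Real.Gamma ((d + k : ℝ) / 2)) := by
  have h := integral_rpow_mul_exp_neg_mul_rpow (p := 2) (q := (d + k : ℝ) - 1) (b := 1 / 2)
    (by norm_num) (by have : (1 : ℝ) ≤ d := by exact_mod_cast hd
                      have : (0 : ℝ) ≤ k := by positivity
                      linarith) (by norm_num)
  rw [sub_add_cancel, neg_div] at h
  rw [← h, radialMoment, ← integral_const_mul]
  refine setIntegral_congr_fun measurableSet_Ioi fun r hr => ?_
  have hr : (0 : ℝ) < r := hr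
  simp only [gaussDensity]
  have h1 : r ^ ((d + k : ℝ) - 1) = r ^ (d - 1) * r ^ k := by
    rw [← pow_add, ← Real.rpow_natCast]
    congr 1
    push_cast [Nat.cast_sub hd]
    ring
  rw [h1]
  norm_cast
  ring

lemma radialMoment_pos (d k : ℕ) (hd : 1 ≤ d) : 0 < radialMoment d k := by
  rw [radialMoment_eq d k hd]
  have hd' : (0 : ℝ) < d := by exact_mod_cast hd
  have := Real.Gamma_pos_of_pos (s := (d + k : ℝ) / 2) (by positivity)
  positivity

/-- The recursion Γ(x+1) = xΓ(x). The factor d is what produces the weight (n−1)⁻¹ in `V2`. -/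
lemma radialMoment_two (d : ℕ) (hd : 1 ≤ d) : radialMoment d 2 = d * radialMoment d 0 := by
  have hd' : (0 : ℝ) < d := by exact_mod_cast hd
  rw [radialMoment_eq d 2 hd, radialMoment_eq d 0 hd]
  push_cast
  rw [show ((d : ℝ) + 2) / 2 = d / 2 + 1 by ring, add_zero, Real.Gamma_add_one (by positivity),
    neg_add, Real.rpow_add (by norm_num)]
  norm_num
  ring

lemma kappa_eq (m : ℕ) : kappa m = π ^ ((m : ℝ) / 2) / Real.Gamma ((m : ℝ) / 2 + 1) := by
  rcases Nat.eq_zero_or_pos m with rfl | hm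
  · have : Metric.closedBall (0 : E 0) 1 = {0} := by
      ext x; simp [Subsingleton.elim x 0]
    rw [kappa, this]
    simp [Measure.real, volume_euclideanSpace_eq_dirac]
  · have : Nonempty (Fin m) := ⟨⟨0, hm⟩⟩
    rw [kappa, Measure.real, EuclideanSpace.volume_closedBall, Fintype.card_fin]
    have h1 : √π ^ m = π ^ ((m : ℝ) / 2) := by
      rw [Real.sqrt_eq_rpow, ← Real.rpow_natCast, ← Real.rpow_mul pi_pos.le]
      congr 1
      ring
    have := Real.Gamma_pos_of_pos (s := (m : ℝ) / 2 + 1) (by positivity)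
    rw [h1]
    simp only [ENNReal.ofReal_one, one_pow, one_mul]
    rw [ENNReal.toReal_ofReal (by positivity)]

lemma kappa_pos (m : ℕ) : 0 < kappa m := by
  have := Real.Gamma_pos_of_pos (s := (m : ℝ) / 2 + 1) (by positivity)
  rw [kappa_eq]
  positivity

/-- The value does not depend on m. This makes `V1` intrinsic: a ball of ℝᵖ keeps its `V1` when it
is embedded in ℝⁿ. -/
lemma kappa_mul_radialMoment_one (m : ℕ) (hm : 1 ≤ m) :
    kappa (m - 1) * radialMoment m 1 = (2 * π) ^ (-(1 / 2) : ℝ) := by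
  have hm' : (0 : ℝ) < m := by exact_mod_cast hm
  have hG := Real.Gamma_pos_of_pos (s := ((m : ℝ) + 1) / 2) (by positivity)
  rw [kappa_eq, radialMoment_eq m 1 hm, Nat.cast_sub hm]
  push_cast
  rw [show ((m : ℝ) - 1) / 2 + 1 = (m + 1) / 2 by ring, Real.mul_rpow (by norm_num) pi_pos.le,
    Real.mul_rpow (by norm_num) pi_pos.le, one_div, Real.inv_rpow (by norm_num),
    Real.rpow_neg (by norm_num : (0 : ℝ) ≤ 2) (((m : ℝ) + 1) / 2), inv_inv]
  have h1 : π ^ (((m : ℝ) - 1) / 2) * π ^ (-(m : ℝ) / 2) = π ^ (-2⁻¹ : ℝ) := by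
    rw [← Real.rpow_add pi_pos]; congr 1; ring
  have h2 : (2 : ℝ) ^ (-(m : ℝ) / 2) * 2 ^ (((m : ℝ) + 1) / 2) * 2⁻¹ = 2 ^ (-2⁻¹ : ℝ) := by
    rw [← Real.rpow_neg_one 2, ← Real.rpow_add (by norm_num), ← Real.rpow_add (by norm_num)]
    congr 1; ring
  rw [← h1, ← h2]
  field_simp

end Gaussian

/-! ### Rotations of Gaussian pairs, integration by parts, Poincaré inequality. -/

section GaussianCalculus

variable {V : Type*} [NormedAddCommGroup V] [InnerProductSpace ℝ V] [FiniteDimensional ℝ V]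
  [MeasurableSpace V] [BorelSpace V]

lemma MemLp.integrable_inner {α : Type*} [MeasurableSpace α] {μ : Measure α} {f g : α → V}
    (hf : MemLp f 2 μ) (hg : MemLp g 2 μ) : Integrable (fun x => inner ℝ (f x) (g x)) μ := by
  refine (hf.norm.integrable_mul hg.norm).mono' (hf.1.inner hg.1) (ae_of_all _ fun x => ?_)
  exact norm_inner_le_norm _ _

lemma memLp_id_stdGaussian : MemLp (fun x : V => x) 2 (stdGaussian V) :=
  IsGaussian.memLp_two_id

lemma LipschitzWith.memLp_stdGaussian {W : Type*} [NormedAddCommGroup W] [SecondCountableTopology W]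
    [MeasurableSpace W] [BorelSpace W] {f : V → W} {C : NNReal} (hf : LipschitzWith C f) :
    MemLp f 2 (stdGaussian V) := by
  have h0 : MemLp (fun x : V => C * ‖x‖) 2 (stdGaussian V) :=
    memLp_id_stdGaussian.norm.const_mul (C : ℝ)
  have h : MemLp (fun x : V => ‖f 0‖ + C * ‖x‖) 2 (stdGaussian V) := (memLp_const ‖f 0‖).add h0
  refine h.of_le hf.continuous.measurable.aestronglyMeasurable (ae_of_all _ fun x => ?_)
  have h1 := hf.dist_le_mul x 0
  rw [dist_eq_norm, dist_zero_right] at h1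
  have h2 := norm_le_norm_add_norm_sub' (f x) (f 0)
  rw [Real.norm_of_nonneg (by positivity)]
  linarith

lemma measurable_gradient (f : V → ℝ) : Measurable (gradient f) :=
  (InnerProductSpace.toDual ℝ V).symm.continuous.measurable.comp (measurable_fderiv ℝ f)

lemma norm_gradient_le {f : V → ℝ} {C : NNReal} (hf : LipschitzWith C f) (x : V) :
    ‖gradient f x‖ ≤ C := by
  rw [gradient, LinearIsometryEquiv.norm_map]
  exact norm_fderiv_le_of_lipschitz ℝ hf

lemma memLp_gradient {f : V → ℝ} {C : NNReal} (hf : LipschitzWith C f) :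
    MemLp (gradient f) 2 (stdGaussian V) :=
  MemLp.of_bound (measurable_gradient f).aestronglyMeasurable C
    (ae_of_all _ (norm_gradient_le hf))

lemma memLp_inner_gradient {f : V → ℝ} {C : NNReal} (hf : LipschitzWith C f) {α : Type*}
    [MeasurableSpace α] {μ : Measure α} {a b : α → V} (ha : Measurable a) (hb : MemLp b 2 μ) :
    MemLp (fun x => inner ℝ (gradient f (a x)) (b x)) 2 μ := by
  refine (hb.norm.const_mul (C : ℝ)).of_le
    (((measurable_gradient f).comp ha).aestronglyMeasurable.inner hb.1) (ae_of_all _ fun x => ?_)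
  rw [Real.norm_of_nonneg (by positivity : 0 ≤ (C : ℝ) * ‖b x‖)]
  exact (norm_inner_le_norm _ _).trans
    (mul_le_mul_of_nonneg_right (norm_gradient_le hf _) (norm_nonneg _))

lemma ae_differentiableAt_stdGaussian {f : V → ℝ} {C : NNReal} (hf : LipschitzWith C f) :
    ∀ᵐ x ∂(stdGaussian V), DifferentiableAt ℝ f x :=
  stdGaussian_absolutelyContinuous.ae_le hf.ae_differentiableAt

lemma integral_inner_mul_inner_stdGaussian (v w : V) :
    ∫ x, inner ℝ v x * inner ℝ w x ∂(stdGaussian V) = inner ℝ v w := by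
  have h := covarianceBilin_apply (μ := stdGaussian V) IsGaussian.memLp_two_id v w
  rw [covarianceBilin_stdGaussian] at h
  simp only [id_eq, integral_id_stdGaussian, sub_zero] at h
  rw [← h]; rfl

lemma integral_inner_stdGaussian (v : V) : ∫ x, inner ℝ v x ∂(stdGaussian V) = 0 :=
  integral_strongDual_stdGaussian (innerSL ℝ v)

/-- The product of two standard Gaussian measures. -/
noncomputable abbrev gaussPair (V : Type*) [NormedAddCommGroup V] [InnerProductSpace ℝ V]
    [FiniteDimensional ℝ V] [MeasurableSpace V] [BorelSpace V] : Measure (V × V) :=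
  (stdGaussian V).prod (stdGaussian V)

lemma measurePreserving_rotation (θ : ℝ) :
    MeasurePreserving (ContinuousLinearMap.rotation θ : V × V →L[ℝ] V × V)
      (gaussPair V) (gaussPair V) :=
  ⟨(ContinuousLinearMap.rotation θ).continuous.measurable,
    IsGaussian.map_rotation_eq_self (by simp) θ⟩

lemma measurePreserving_rotation_fst (θ : ℝ) :
    MeasurePreserving (fun p : V × V => cos θ • p.1 + sin θ • p.2) (gaussPair V)
      (stdGaussian V) :=
  measurePreserving_fst.comp (measurePreserving_rotation θ)

/-- Invariance of integrals under `(x, y) ↦ (cos θ x - sin θ y, ·)`, as a change of variables from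
`(x_θ, y_θ)` back to `(x, y)`. -/
lemma integral_rotation (θ : ℝ) (F : V → V → V → ℝ)
    (hF : Measurable fun p : V × V => F (cos θ • p.1 - sin θ • p.2) p.1 p.2) :
    ∫ p, F p.1 (cos θ • p.1 + sin θ • p.2) (-sin θ • p.1 + cos θ • p.2) ∂(gaussPair V) =
      ∫ p, F (cos θ • p.1 - sin θ • p.2) p.1 p.2 ∂(gaussPair V) := by
  have h := integral_map (μ := gaussPair V) (measurePreserving_rotation (V := V) θ).measurable.aemeasurable
    (f := fun p : V × V => F (cos θ • p.1 - sin θ • p.2) p.1 p.2) hF.aestronglyMeasurable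
  rw [(measurePreserving_rotation θ).map_eq] at h
  rw [h]
  refine integral_congr_ae (ae_of_all _ fun p => ?_)
  simp only [ContinuousLinearMap.rotation_apply]
  congr 1
  have h1 := Real.cos_sq_add_sin_sq θ
  rw [smul_add, smul_add, smul_smul, smul_smul, smul_smul, smul_smul, add_sub_add_comm, ← sub_smul,
    ← sub_smul]
  rw [show cos θ * cos θ - sin θ * -sin θ = 1 by nlinarith,
    show cos θ * sin θ - sin θ * cos θ = 0 by ring]
  simp

lemma hasDerivAt_rotation_fst (p : V × V) (θ : ℝ) :
    HasDerivAt (fun θ : ℝ => cos θ • p.1 + sin θ • p.2) (-sin θ • p.1 + cos θ • p.2) θ :=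
  ((hasDerivAt_cos θ).smul_const p.1).add ((hasDerivAt_sin θ).smul_const p.2)

variable {f g : V → ℝ} {C D : NNReal}

lemma integrable_mul_rotation (hg : LipschitzWith D g) (hf : LipschitzWith C f) (θ : ℝ) :
    Integrable (fun p : V × V => g p.1 * f (cos θ • p.1 + sin θ • p.2)) (gaussPair V) :=
  (((LipschitzWith.memLp_stdGaussian hg).comp_measurePreserving
    measurePreserving_fst).integrable_mul
    ((LipschitzWith.memLp_stdGaussian hf).comp_measurePreserving
      (measurePreserving_rotation_fst θ)) :)

/-- Rademacher's theorem suffices: for fixed θ the rotated point is again Gaussian, so f is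
differentiable there for almost every pair, and the Lipschitz bound dominates the difference
quotients. -/
lemma hasDerivAt_integral_rotation (hg : LipschitzWith D g) (hf : LipschitzWith C f) (θ : ℝ) :
    HasDerivAt (fun θ => ∫ p, g p.1 * f (cos θ • p.1 + sin θ • p.2) ∂(gaussPair V))
      (∫ p, g p.1 * inner ℝ (gradient f (cos θ • p.1 + sin θ • p.2))
        (-sin θ • p.1 + cos θ • p.2) ∂(gaussPair V)) θ := by
  have hgc := hg.continuous
  have hfc := hf.continuous
  have hm1 : Measurable fun p : V × V => gradient f (cos θ • p.1 + sin θ • p.2) :=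
    (measurable_gradient f).comp (by fun_prop)
  refine (hasDerivAt_integral_of_dominated_loc_of_lip (s := Set.univ)
    (bound := fun p => |g p.1| * (C * (‖p.1‖ + ‖p.2‖))) univ_mem
    (Eventually.of_forall fun θ => ?_) (integrable_mul_rotation hg hf θ) ?_
    (ae_of_all _ fun p => ?_) ?_ ?_).2
  · exact Measurable.aestronglyMeasurable (by fun_prop)
  · refine Measurable.aestronglyMeasurable (Measurable.mul (by fun_prop) ?_)
    exact hm1.inner (by fun_prop)
  · refine LipschitzOnWith.of_dist_le_mul fun s _ t _ => ?_
    rw [Real.dist_eq, Real.dist_eq, ← mul_sub, abs_mul, Real.coe_nnabs,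
      abs_of_nonneg (a := |g p.1| * (C * (‖p.1‖ + ‖p.2‖))) (by positivity), mul_assoc]
    refine mul_le_mul_of_nonneg_left ?_ (abs_nonneg _)
    have h1 := hf.dist_le_mul (cos s • p.1 + sin s • p.2) (cos t • p.1 + sin t • p.2)
    rw [Real.dist_eq, dist_eq_norm] at h1
    refine h1.trans ?_
    rw [mul_assoc]
    refine mul_le_mul_of_nonneg_left ?_ C.coe_nonneg
    rw [add_sub_add_comm, ← sub_smul, ← sub_smul]
    refine (norm_add_le _ _).trans ?_
    rw [norm_smul, norm_smul, Real.norm_eq_abs, Real.norm_eq_abs]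
    have h2 := Real.abs_cos_sub_cos_le s t
    have h3 := Real.abs_sin_sub_sin_le s t
    have := mul_le_mul_of_nonneg_right h2 (norm_nonneg p.1)
    have := mul_le_mul_of_nonneg_right h3 (norm_nonneg p.2)
    linarith
  · have h1 : MemLp (fun p : V × V => |g p.1|) 2 (gaussPair V) :=
      ((LipschitzWith.memLp_stdGaussian hg).comp_measurePreserving measurePreserving_fst).abs
    have h2 : MemLp (fun p : V × V => C * (‖p.1‖ + ‖p.2‖)) 2 (gaussPair V) :=
      ((memLp_id_stdGaussian.norm.comp_measurePreserving measurePreserving_fst).add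
        (memLp_id_stdGaussian.norm.comp_measurePreserving measurePreserving_snd)).const_mul _
    exact h1.integrable_mul h2
  · filter_upwards [(measurePreserving_rotation_fst (V := V) θ).quasiMeasurePreserving.ae
      (ae_differentiableAt_stdGaussian hf)] with p hp
    rw [inner_gradient_left]
    exact (hp.hasFDerivAt.comp_hasDerivAt θ (hasDerivAt_rotation_fst p θ)).const_mul _

/-- Gaussian integration by parts. By rotation invariance E⟨v, X⟩f(cos θ X + sin θ Y) = cos θ · E⟨v,
X⟩f(X); the identity comes from differentiating both sides at θ = π/2. -/
theorem integral_inner_mul_stdGaussian (hf : LipschitzWith C f) (v : V) :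
    ∫ x, inner ℝ v x * f x ∂(stdGaussian V) =
      ∫ x, inner ℝ v (gradient f x) ∂(stdGaussian V) := by
  have hfc := hf.continuous
  have hv : LipschitzWith ‖innerSL ℝ v‖₊ (fun x : V => inner ℝ v x) := (innerSL ℝ v).lipschitz
  have hm := measurable_gradient f
  have h1 := hasDerivAt_integral_rotation hv hf (π / 2)
  have hMv := LipschitzWith.memLp_stdGaussian hv
  have hMf := LipschitzWith.memLp_stdGaussian hf
  have h2 : ∀ θ : ℝ, ∫ p : V × V, inner ℝ v p.1 * f (cos θ • p.1 + sin θ • p.2) ∂(gaussPair V) =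
      cos θ * ∫ x, inner ℝ v x * f x ∂(stdGaussian V) := by
    intro θ
    rw [integral_rotation θ (fun a b _ => inner ℝ v a * f b) (by fun_prop)]
    simp_rw [inner_sub_right, inner_smul_right, sub_mul]
    have i1 : Integrable (fun p : V × V => inner ℝ v p.1 * f p.1) (gaussPair V) :=
      (hMv.integrable_mul hMf).comp_fst _
    have i2 : Integrable (fun p : V × V => f p.1 * inner ℝ v p.2) (gaussPair V) :=
      (hMf.integrable (by norm_num)).mul_prod (hMv.integrable (by norm_num))
    rw [integral_sub (by simpa only [mul_assoc] using i1.const_mul _)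
      (by simpa only [mul_assoc, mul_comm (f _)] using i2.const_mul (sin θ))]
    simp_rw [mul_assoc]
    rw [integral_const_mul, integral_const_mul]
    have e1 : ∫ p : V × V, inner ℝ v p.1 * f p.1 ∂(gaussPair V) =
        ∫ x, inner ℝ v x * f x ∂(stdGaussian V) := by
      rw [integral_fun_fst (fun x => inner ℝ v x * f x)]; simp
    have e2 : ∫ p : V × V, inner ℝ v p.2 * f p.1 ∂(gaussPair V) = 0 := by
      simp_rw [mul_comm (inner ℝ v _)]
      rw [integral_prod_mul f (fun y => inner ℝ v y), integral_inner_stdGaussian, mul_zero]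
    rw [e1, e2]; ring
  have h3 : HasDerivAt (fun θ => cos θ * ∫ x, inner ℝ v x * f x ∂(stdGaussian V))
      (-sin (π / 2) * ∫ x, inner ℝ v x * f x ∂(stdGaussian V)) (π / 2) :=
    (hasDerivAt_cos _).mul_const _
  simp_rw [h2] at h1
  have h4 := h3.unique h1
  simp only [sin_pi_div_two, cos_pi_div_two, zero_smul, one_smul, zero_add, add_zero, neg_smul,
    inner_neg_right, mul_neg, neg_mul, one_mul, integral_neg, neg_inj] at h4
  rw [h4, integral_prod_symm]
  · simp_rw [integral_inner_mul_inner_stdGaussian]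
  · exact (hMv.comp_measurePreserving (measurePreserving_fst (ν := stdGaussian V))).integrable_mul
      (memLp_inner_gradient hf measurable_snd
        (memLp_id_stdGaussian.comp_measurePreserving (measurePreserving_fst)))

lemma gradient_comp_sub_smul (g : V → ℝ) (a y : V) (s : ℝ) :
    gradient (fun y => g (a - s • y)) y = -s • gradient g (a - s • y) := by
  have h : (fun y => g (a - s • y)) = fun y => (fun z => g (a + z)) ((-s) • y) := by
    ext y; rw [neg_smul, sub_eq_add_neg]
  rw [gradient, gradient, h, fderiv_comp_smul (f := fun z => g (a + z)),
    fderiv_comp_add_left, map_smul, neg_smul, sub_eq_add_neg]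
  simp

/-- The mixed energy `E ⟨∇g(X), ∇f(cos θ X + sin θ Y)⟩`. -/
noncomputable def mixedEnergy (g f : V → ℝ) (θ : ℝ) : ℝ :=
  ∫ p, inner ℝ (gradient g p.1) (gradient f (cos θ • p.1 + sin θ • p.2)) ∂(gaussPair V)

/-- The correlation `E g(X) f(cos θ X + sin θ Y)`. -/
noncomputable def gaussCorr (g f : V → ℝ) (θ : ℝ) : ℝ :=
  ∫ p, g p.1 * f (cos θ • p.1 + sin θ • p.2) ∂(gaussPair V)

/-- After the rotation, f depends on one Gaussian variable only. Integration by parts in the other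
variable moves the derivative onto g, and the chain rule there yields −sin θ. -/
theorem hasDerivAt_gaussCorr (hg : LipschitzWith D g) (hf : LipschitzWith C f) (θ : ℝ) :
    HasDerivAt (gaussCorr g f) (-sin θ * mixedEnergy g f θ) θ := by
  suffices h : -sin θ * mixedEnergy g f θ = ∫ p, g p.1 * inner ℝ
      (gradient f (cos θ • p.1 + sin θ • p.2)) (-sin θ • p.1 + cos θ • p.2) ∂(gaussPair V) by
    rw [h]; exact hasDerivAt_integral_rotation hg hf θ
  have hgc := hg.continuous
  have hfc := hf.continuous
  have hmf := measurable_gradient f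
  have hmg := measurable_gradient g
  have hgs : ∀ (x : V) (s : ℝ), LipschitzWith (D * ‖s‖₊) (fun y => g (x - s • y)) := by
    intro x s
    refine hg.comp (LipschitzWith.of_dist_le_mul fun y z => ?_)
    rw [dist_sub_left, dist_smul₀]
    rfl
  rw [mixedEnergy, integral_rotation θ (fun a b _ => inner ℝ (gradient g a) (gradient f b))
      (by fun_prop), integral_rotation θ (fun a b c => g a * inner ℝ (gradient f b) c)
      (by fun_prop)]
  have hr := (measurePreserving_rotation_fst (V := V) (-θ))
  simp only [cos_neg, sin_neg, neg_smul, ← sub_eq_add_neg] at hr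
  rw [integral_prod, integral_prod, ← integral_const_mul]
  · refine integral_congr_ae (ae_of_all _ fun x => ?_)
    have h := integral_inner_mul_stdGaussian (hgs (cos θ • x) (sin θ)) (gradient f x)
    simp only at h ⊢
    simp_rw [mul_comm (g _), h, gradient_comp_sub_smul, inner_smul_right, integral_const_mul,
      real_inner_comm]
  · exact ((LipschitzWith.memLp_stdGaussian hg).comp_measurePreserving hr).integrable_mul
      (memLp_inner_gradient hf measurable_fst
        (memLp_id_stdGaussian.comp_measurePreserving measurePreserving_snd))
  · exact MemLp.integrable_inner ((memLp_gradient hg).comp_measurePreserving hr)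
      ((memLp_gradient hf).comp_measurePreserving measurePreserving_fst)

lemma gaussCorr_zero (g f : V → ℝ) :
    gaussCorr g f 0 = ∫ x, g x * f x ∂(stdGaussian V) := by
  simp only [gaussCorr, cos_zero, sin_zero, one_smul, zero_smul, add_zero]
  rw [integral_fun_fst (fun x => g x * f x)]; simp

lemma gaussCorr_pi_div_two (g f : V → ℝ) :
    gaussCorr g f (π / 2) = (∫ x, g x ∂(stdGaussian V)) * ∫ x, f x ∂(stdGaussian V) := by
  simp only [gaussCorr, cos_pi_div_two, sin_pi_div_two, one_smul, zero_smul, zero_add]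
  exact integral_prod_mul g f

lemma mixedEnergy_zero (g f : V → ℝ) :
    mixedEnergy g f 0 = ∫ x, inner ℝ (gradient g x) (gradient f x) ∂(stdGaussian V) := by
  simp only [mixedEnergy, cos_zero, sin_zero, one_smul, zero_smul, add_zero]
  rw [integral_fun_fst (fun x => inner ℝ (gradient g x) (gradient f x))]; simp

/-- Expand the square; both gradients are taken at standard Gaussian points. The consequence needed
is that `mixedEnergy f f` is largest at θ = 0. -/
lemma integral_norm_gradient_sub_sq (hf : LipschitzWith C f) (θ : ℝ) :
    ∫ p, ‖gradient f p.1 - gradient f (cos θ • p.1 + sin θ • p.2)‖ ^ 2 ∂(gaussPair V) =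
      2 * (mixedEnergy f f 0 - mixedEnergy f f θ) := by
  have h1 := (memLp_gradient hf).comp_measurePreserving
    (measurePreserving_fst (μ := stdGaussian V) (ν := stdGaussian V))
  have h2 := (memLp_gradient hf).comp_measurePreserving (measurePreserving_rotation_fst (V := V) θ)
  have i1 := MemLp.integrable_inner h1 h1
  have i2 := MemLp.integrable_inner h2 h2
  have i12 := MemLp.integrable_inner h1 h2
  have e2 : ∫ p : V × V, inner ℝ (gradient f (cos θ • p.1 + sin θ • p.2))
      (gradient f (cos θ • p.1 + sin θ • p.2)) ∂(gaussPair V) =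
      ∫ x, inner ℝ (gradient f x) (gradient f x) ∂(stdGaussian V) := by
    rw [← (measurePreserving_rotation_fst (V := V) θ).map_eq, integral_map]
    · exact (measurePreserving_rotation_fst θ).measurable.aemeasurable
    · exact ((measurable_gradient f).inner (measurable_gradient f)).aestronglyMeasurable
  have e1 : ∫ p : V × V, inner ℝ (gradient f p.1) (gradient f p.1) ∂(gaussPair V) =
      ∫ x, inner ℝ (gradient f x) (gradient f x) ∂(stdGaussian V) := by
    rw [integral_fun_fst (fun x => inner ℝ (gradient f x) (gradient f x))]; simp
  simp only [Function.comp_def] at i1 i2 i12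
  simp_rw [← real_inner_self_eq_norm_sq, real_inner_sub_sub_self]
  have i3 : Integrable (fun p : V × V => inner ℝ (gradient f p.1) (gradient f p.1) -
      2 * inner ℝ (gradient f p.1) (gradient f (cos θ • p.1 + sin θ • p.2))) (gaussPair V) :=
    i1.sub (i12.const_mul 2)
  rw [integral_add i3 i2, integral_sub i1 (i12.const_mul 2),
    integral_const_mul, e1, e2, mixedEnergy_zero, mixedEnergy]
  ring

lemma hasDerivAt_gaussCorr_sub (hf : LipschitzWith C f) (θ : ℝ) :
    HasDerivAt (fun θ => gaussCorr f f θ - mixedEnergy f f 0 * cos θ)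
      (sin θ * (mixedEnergy f f 0 - mixedEnergy f f θ)) θ := by
  have h := (hasDerivAt_gaussCorr hf hf θ).sub ((hasDerivAt_cos θ).const_mul (mixedEnergy f f 0))
  rw [show sin θ * (mixedEnergy f f 0 - mixedEnergy f f θ) =
    -sin θ * mixedEnergy f f θ - mixedEnergy f f 0 * -sin θ by ring]
  exact h

lemma monotoneOn_gaussCorr_sub (hf : LipschitzWith C f) :
    MonotoneOn (fun θ => gaussCorr f f θ - mixedEnergy f f 0 * cos θ) (Set.Icc 0 (π / 2)) := by
  refine monotoneOn_of_deriv_nonneg (convex_Icc _ _)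
    (fun θ _ => (hasDerivAt_gaussCorr_sub hf θ).continuousAt.continuousWithinAt)
    (fun θ _ => (hasDerivAt_gaussCorr_sub hf θ).differentiableAt.differentiableWithinAt)
    fun θ hθ => ?_
  rw [interior_Icc] at hθ
  rw [(hasDerivAt_gaussCorr_sub hf θ).deriv]
  have h1 := integral_norm_gradient_sub_sq hf θ
  have h2 : 0 ≤ ∫ p, ‖gradient f p.1 - gradient f (cos θ • p.1 + sin θ • p.2)‖ ^ 2
    ∂(gaussPair V) := integral_nonneg fun p => by positivity
  exact mul_nonneg (sin_nonneg_of_nonneg_of_le_pi hθ.1.le (by linarith [hθ.2, pi_pos]))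
    (by linarith)

/-- **Gaussian Poincaré inequality** for Lipschitz functions. -/
theorem gaussian_poincare (hf : LipschitzWith C f) :
    ∫ x, f x * f x ∂(stdGaussian V) - (∫ x, f x ∂(stdGaussian V)) ^ 2 ≤
      ∫ x, inner ℝ (gradient f x) (gradient f x) ∂(stdGaussian V) := by
  have h := monotoneOn_gaussCorr_sub hf (Set.left_mem_Icc.2 (by positivity))
    (Set.right_mem_Icc.2 (by positivity)) (by positivity)
  simp only [gaussCorr_zero, gaussCorr_pi_div_two, mixedEnergy_zero, cos_zero,
    cos_pi_div_two] at h
  linarith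

end GaussianCalculus

/-! ### The Gaussian form: definiteness and positivity. -/

section GaussianForm

variable {V : Type*} [NormedAddCommGroup V] [InnerProductSpace ℝ V] [FiniteDimensional ℝ V]
  [MeasurableSpace V] [BorelSpace V] {f g : V → ℝ} {C D : NNReal}

/-- The quadratic form `E (f g) - E ⟨∇f, ∇g⟩` for the standard Gaussian measure. -/
noncomputable def gaussForm (f g : V → ℝ) : ℝ :=
  ∫ x, f x * g x ∂(stdGaussian V) -
    ∫ x, inner ℝ (gradient f x) (gradient g x) ∂(stdGaussian V)

/-- The gradient is only measurable and bounded, so continuity comes from the strong continuity in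
L² of composition with measure-preserving maps. -/
lemma continuous_mixedEnergy (hg : LipschitzWith D g) (hf : LipschitzWith C f) :
    Continuous (mixedEnergy g f) := by
  have hmg := (memLp_gradient hg).comp_measurePreserving
    (measurePreserving_fst (μ := stdGaussian V) (ν := stdGaussian V))
  let R : ℝ → C(V × V, V) := fun θ => ⟨fun p => cos θ • p.1 + sin θ • p.2, by fun_prop⟩
  have hR : Continuous R := ContinuousMap.continuous_of_continuous_uncurry _ (by
    simp only [R, Function.uncurry_def, ContinuousMap.coe_mk]; fun_prop)
  have hRm : ∀ θ, MeasurePreserving (R θ) (gaussPair V) (stdGaussian V) :=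
    measurePreserving_rotation_fst
  have h1 : Continuous fun θ => Lp.compMeasurePreserving (R θ) (hRm θ) (memLp_gradient hf).toLp :=
    Continuous.compMeasurePreservingLp continuous_const hR hRm (by norm_num)
  have h2 : mixedEnergy g f = fun θ => inner ℝ (hmg.toLp)
      (Lp.compMeasurePreserving (R θ) (hRm θ) (memLp_gradient hf).toLp) := by
    ext θ
    rw [L2.inner_def, mixedEnergy]
    refine integral_congr_ae ?_
    filter_upwards [hmg.coeFn_toLp, Lp.coeFn_compMeasurePreserving (memLp_gradient hf).toLp (hRm θ),
      (hRm θ).quasiMeasurePreserving.ae (memLp_gradient hf).coeFn_toLp] with p h3 h4 h5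
    rw [h3, h4]
    exact congrArg (inner ℝ (gradient g p.1)) h5.symm
  rw [h2]
  exact continuous_const.inner h1

/-- With M = E|∇f|², the function `gaussCorr f f θ` − M cos θ is nondecreasing on [0, π/2],
nonnegative at 0 by `hQ`, and zero at π/2; hence it vanishes identically. Its derivative at π/2
gives M = |E∇f|², which is zero by integration by parts and `h1`. The Poincaré inequality then kills
f. -/
theorem eq_zero_of_energy_le (hf : LipschitzWith C f)
    (h0 : ∫ x, f x ∂(stdGaussian V) = 0)
    (h1 : ∀ v : V, ∫ x, inner ℝ v x * f x ∂(stdGaussian V) = 0)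
    (hQ : 0 ≤ gaussForm f f) (x : V) : f x = 0 := by
  set M := mixedEnergy f f 0 with hM
  have hd : ∀ θ, HasDerivAt (fun θ => gaussCorr f f θ - M * cos θ)
      (sin θ * (M - mixedEnergy f f θ)) θ := hasDerivAt_gaussCorr_sub hf
  have hmono := monotoneOn_gaussCorr_sub hf
  rw [gaussForm, ← mixedEnergy_zero, ← gaussCorr_zero] at hQ
  have hz : ∀ θ ∈ Set.Icc 0 (π / 2), gaussCorr f f θ - M * cos θ = 0 := by
    intro θ hθ
    have a1 := hmono (Set.left_mem_Icc.2 (by positivity)) hθ hθ.1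
    have a2 := hmono hθ (Set.right_mem_Icc.2 (by positivity)) hθ.2
    simp only [gaussCorr_pi_div_two, h0, cos_pi_div_two, cos_zero] at a1 a2
    linarith
  have hpi : π / 2 ∈ Set.Icc 0 (π / 2) := Set.right_mem_Icc.2 (by positivity)
  have e1 : sin (π / 2) * (M - mixedEnergy f f (π / 2)) = 0 := by
    -- The function is known to vanish only to the left of π/2, so a one-sided derivative is used.
    refine UniqueDiffWithinAt.eq_deriv (Set.Icc 0 (π / 2))
      (uniqueDiffOn_Icc (by positivity) _ hpi) (hd (π / 2)).hasDerivWithinAt ?_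
    exact (hasDerivWithinAt_const _ _ (0 : ℝ)).congr hz (hz _ hpi)
  have e2 : mixedEnergy f f (π / 2) = 0 := by
    have i : Integrable (fun p : V × V => inner ℝ (gradient f p.1) (gradient f p.2))
        (gaussPair V) :=
      MemLp.integrable_inner ((memLp_gradient hf).comp_measurePreserving measurePreserving_fst)
        ((memLp_gradient hf).comp_measurePreserving measurePreserving_snd)
    simp only [mixedEnergy, cos_pi_div_two, sin_pi_div_two, one_smul, zero_smul, zero_add]
    rw [integral_prod _ i]
    simp_rw [← integral_inner_mul_stdGaussian hf, h1]
    simp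
  rw [e2, sin_pi_div_two, sub_zero, one_mul] at e1
  have h2 := gaussian_poincare hf
  rw [h0, ← mixedEnergy_zero, ← hM, e1] at h2
  have hff : Integrable (fun x => f x * f x) (stdGaussian V) :=
    (LipschitzWith.memLp_stdGaussian hf).integrable_mul (LipschitzWith.memLp_stdGaussian hf)
  have h3 : (fun x => f x * f x) =ᵐ[stdGaussian V] 0 :=
    (integral_eq_zero_iff_of_nonneg (fun x => mul_self_nonneg (f x)) hff).1
      (le_antisymm (by linarith) (integral_nonneg fun x => mul_self_nonneg (f x)))
  have h4 := (hf.continuous.mul hf.continuous).ae_eq_iff_eq (stdGaussian V)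
    continuous_zero |>.1 h3
  exact mul_self_eq_zero.1 (congrFun h4 x)

/-- Symmetrize under Y ↦ −Y: sublinearity gives f(cos θ X + sin θ Y) + f(cos θ X − sin θ Y) ≥ 2 cos
θ f(X), and g ≥ 0 preserves the inequality. -/
lemma cos_mul_gaussCorr_zero_le (hg : LipschitzWith D g) (hf : LipschitzWith C f)
    (hg0 : ∀ x, 0 ≤ g x) (hadd : ∀ x y, f (x + y) ≤ f x + f y)
    (hsmul : ∀ (r : ℝ) (x : V), 0 ≤ r → f (r • x) = r * f x) {θ : ℝ} (hθ : 0 ≤ cos θ) :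
    cos θ * gaussCorr g f 0 ≤ gaussCorr g f θ := by
  have i1 := integrable_mul_rotation hg hf θ
  have i2 := integrable_mul_rotation hg hf (-θ)
  have i0 := integrable_mul_rotation hg hf 0
  simp only [cos_zero, sin_zero, one_smul, zero_smul, add_zero, cos_neg, sin_neg] at i0 i2
  have hneg : MeasurePreserving (Prod.map id Neg.neg : V × V → V × V) (gaussPair V)
      (gaussPair V) := by
    refine (MeasurePreserving.id _).prod ⟨measurable_neg, ?_⟩
    exact stdGaussian_map (LinearIsometryEquiv.neg ℝ (E := V))
  have hfc := hf.continuous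
  have hgc := hg.continuous
  have e2 : ∫ p : V × V, g p.1 * f (cos θ • p.1 + -sin θ • p.2) ∂(gaussPair V) =
      gaussCorr g f θ := by
    rw [gaussCorr, ← hneg.map_eq, integral_map hneg.measurable.aemeasurable
      (Measurable.aestronglyMeasurable (by fun_prop)), hneg.map_eq]
    simp
  have e0 : cos θ * gaussCorr g f 0 = ∫ p : V × V, cos θ * (g p.1 * f p.1) ∂(gaussPair V) := by
    rw [integral_const_mul, gaussCorr]
    simp
  have h2 : 2 * (cos θ * gaussCorr g f 0) ≤ gaussCorr g f θ + gaussCorr g f θ := by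
    nth_rw 2 [← e2]
    rw [e0, gaussCorr, ← integral_add i1 i2, ← integral_const_mul]
    refine integral_mono ((i0.const_mul _).const_mul _) (i1.add i2) fun p => ?_
    have h3 := hadd (cos θ • p.1 + sin θ • p.2) (cos θ • p.1 + -sin θ • p.2)
    rw [show cos θ • p.1 + sin θ • p.2 + (cos θ • p.1 + -sin θ • p.2) = (2 * cos θ) • p.1 by
      module, hsmul _ _ (by positivity)] at h3
    have h4 := mul_le_mul_of_nonneg_left h3 (hg0 p.1)
    simp only
    linarith
  linarith

/-- A negative value would make `gaussCorr g f θ` − `gaussCorr g f 0` cos θ strictly decreasing near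
θ = 0, where it starts at zero. This contradicts `cos_mul_gaussCorr_zero_le`. -/
theorem gaussForm_nonneg (hg : LipschitzWith D g) (hf : LipschitzWith C f)
    (hg0 : ∀ x, 0 ≤ g x) (hadd : ∀ x y, f (x + y) ≤ f x + f y)
    (hsmul : ∀ (r : ℝ) (x : V), 0 ≤ r → f (r • x) = r * f x) : 0 ≤ gaussForm g f := by
  by_contra! hneg
  rw [gaussForm, ← gaussCorr_zero, ← mixedEnergy_zero] at hneg
  have hcont := (continuous_mixedEnergy hg hf).tendsto 0
  obtain ⟨δ, hδ, hδ'⟩ := Metric.eventually_nhds_iff.1 (hcont.eventually_const_lt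
    (show gaussCorr g f 0 < mixedEnergy g f 0 by linarith))
  -- The bound 1 keeps ε below π/2, so that its sine is positive and its cosine nonnegative.
  set ε := min (δ / 2) 1 with hε
  have hε0 : 0 < ε := by positivity
  have hε1 : ε ≤ 1 := min_le_right _ _
  have hεδ : ε < δ := lt_of_le_of_lt (min_le_left _ _) (by linarith)
  have hpi := pi_gt_three
  have hd : ∀ θ, HasDerivAt (fun θ => gaussCorr g f θ - gaussCorr g f 0 * cos θ)
      (sin θ * (gaussCorr g f 0 - mixedEnergy g f θ)) θ := fun θ => by
    have h := (hasDerivAt_gaussCorr hg hf θ).sub ((hasDerivAt_cos θ).const_mul (gaussCorr g f 0))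
    rw [show sin θ * (gaussCorr g f 0 - mixedEnergy g f θ) =
      -sin θ * mixedEnergy g f θ - gaussCorr g f 0 * -sin θ by ring]
    exact h
  have hanti : StrictAntiOn (fun θ => gaussCorr g f θ - gaussCorr g f 0 * cos θ)
      (Set.Icc 0 ε) := by
    refine strictAntiOn_of_deriv_neg (convex_Icc _ _)
      (fun θ _ => (hd θ).continuousAt.continuousWithinAt) fun θ hθ => ?_
    rw [interior_Icc] at hθ
    rw [(hd θ).deriv]
    refine mul_neg_of_pos_of_neg (sin_pos_of_pos_of_lt_pi hθ.1 (by linarith [hθ.2])) ?_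
    have := hδ' (y := θ) (by
      rw [Real.dist_eq, sub_zero, abs_of_pos hθ.1]; linarith [hθ.2])
    linarith
  have h := hanti (Set.left_mem_Icc.2 hε0.le) (Set.right_mem_Icc.2 hε0.le) hε0
  have h2 := cos_mul_gaussCorr_zero_le hg hf hg0 hadd hsmul (θ := ε)
    (cos_nonneg_of_neg_pi_div_two_le_of_le (by linarith) (by linarith))
  simp only [cos_zero] at h
  linarith

lemma gaussForm_comm (f g : V → ℝ) : gaussForm f g = gaussForm g f := by
  simp only [gaussForm, mul_comm (f _), real_inner_comm]

lemma gaussForm_add_smul {f₁ f₂ g : V → ℝ} {C₁ C₂ D : NNReal} (h₁ : LipschitzWith C₁ f₁)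
    (h₂ : LipschitzWith C₂ f₂) (hg : LipschitzWith D g) (a b : ℝ) :
    gaussForm (fun x => a * f₁ x + b * f₂ x) g = a * gaussForm f₁ g + b * gaussForm f₂ g := by
  have m := LipschitzWith.memLp_stdGaussian hg
  have m1 := LipschitzWith.memLp_stdGaussian h₁
  have m2 := LipschitzWith.memLp_stdGaussian h₂
  have e1 : ∫ x, (a * f₁ x + b * f₂ x) * g x ∂(stdGaussian V) =
      a * ∫ x, f₁ x * g x ∂(stdGaussian V) + b * ∫ x, f₂ x * g x ∂(stdGaussian V) := by
    have i1 : Integrable (fun x => a * (f₁ x * g x)) (stdGaussian V) :=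
      (m1.integrable_mul m).const_mul a
    have i2 : Integrable (fun x => b * (f₂ x * g x)) (stdGaussian V) :=
      (m2.integrable_mul m).const_mul b
    rw [← integral_const_mul, ← integral_const_mul, ← integral_add i1 i2]
    refine integral_congr_ae (ae_of_all _ fun x => ?_)
    simp only
    ring
  have e2 : ∫ x, inner ℝ (gradient (fun x => a * f₁ x + b * f₂ x) x) (gradient g x)
      ∂(stdGaussian V) = a * ∫ x, inner ℝ (gradient f₁ x) (gradient g x) ∂(stdGaussian V) +
        b * ∫ x, inner ℝ (gradient f₂ x) (gradient g x) ∂(stdGaussian V) := by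
    rw [← integral_const_mul, ← integral_const_mul, ← integral_add
      ((MemLp.integrable_inner (memLp_gradient h₁) (memLp_gradient hg)).const_mul a)
      ((MemLp.integrable_inner (memLp_gradient h₂) (memLp_gradient hg)).const_mul b)]
    refine integral_congr_ae ?_
    filter_upwards [ae_differentiableAt_stdGaussian h₁, ae_differentiableAt_stdGaussian h₂]
      with x hx1 hx2
    have hd : HasFDerivAt (fun x => a * f₁ x + b * f₂ x) (a • fderiv ℝ f₁ x + b • fderiv ℝ f₂ x)
      x := (hx1.hasFDerivAt.const_mul a).add (hx2.hasFDerivAt.const_mul b)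
    rw [inner_gradient_left, inner_gradient_left, inner_gradient_left, hd.fderiv]
    simp
  rw [gaussForm, e1, e2, gaussForm, gaussForm]
  ring

/-- Integration by parts puts linear functions into the radical of the form, so translating a body
does not change it. -/
lemma gaussForm_inner_left (hf : LipschitzWith C f) (v : V) :
    gaussForm (fun x => inner ℝ v x) f = 0 := by
  have h : ∀ x : V, gradient (fun x : V => inner ℝ v x) x = v := fun x => by
    refine HasGradientAt.gradient ?_
    exact (innerSL ℝ v).hasFDerivAt
  simp only [gaussForm, h]
  rw [integral_inner_mul_stdGaussian hf, sub_self]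

end GaussianForm

/-! ### Support functions as homogeneous Lipschitz functions on ℝⁿ. -/

section SupportFunction

variable {n : ℕ}

/-- The support function of a convex body on the whole space. -/
noncomputable def suppExt (K : ConvexBody (E n)) (x : E n) : ℝ :=
  sSup ((fun y : E n => inner ℝ x y) '' (K : Set (E n)))

lemma supp_eq_suppExt (K : ConvexBody (E n)) (u : S n) : supp K u = suppExt K u := rfl

lemma isCompact_image_inner (K : ConvexBody (E n)) (x : E n) :
    IsCompact ((fun y : E n => inner ℝ x y) '' (K : Set (E n))) :=
  K.isCompact.image (by fun_prop)

lemma inner_le_suppExt (K : ConvexBody (E n)) (x : E n) {y : E n} (hy : y ∈ (K : Set (E n))) :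
    inner ℝ x y ≤ suppExt K x :=
  le_csSup (isCompact_image_inner K x).bddAbove ⟨y, hy, rfl⟩

lemma exists_suppExt_eq (K : ConvexBody (E n)) (x : E n) :
    ∃ y ∈ (K : Set (E n)), suppExt K x = inner ℝ x y := by
  obtain ⟨y, hy, h⟩ := (isCompact_image_inner K x).sSup_mem (K.nonempty.image _)
  exact ⟨y, hy, h.symm⟩

lemma suppExt_le (K : ConvexBody (E n)) {x : E n} {a : ℝ}
    (h : ∀ y ∈ (K : Set (E n)), inner ℝ x y ≤ a) : suppExt K x ≤ a := by
  obtain ⟨y, hy, e⟩ := exists_suppExt_eq K x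
  exact e ▸ h y hy

lemma suppExt_add_le (K : ConvexBody (E n)) (x y : E n) :
    suppExt K (x + y) ≤ suppExt K x + suppExt K y := by
  refine suppExt_le K fun z hz => ?_
  rw [inner_add_left]
  exact add_le_add (inner_le_suppExt K x hz) (inner_le_suppExt K y hz)

lemma suppExt_smul (K : ConvexBody (E n)) (r : ℝ) (x : E n) (hr : 0 ≤ r) :
    suppExt K (r • x) = r * suppExt K x := by
  refine le_antisymm (suppExt_le K fun z hz => ?_) ?_
  · rw [real_inner_smul_left]
    exact mul_le_mul_of_nonneg_left (inner_le_suppExt K x hz) hr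
  · obtain ⟨y, hy, e⟩ := exists_suppExt_eq K x
    rw [e, ← real_inner_smul_left]
    exact inner_le_suppExt K _ hy

lemma exists_lipschitzWith_suppExt (K : ConvexBody (E n)) :
    ∃ C, LipschitzWith C (suppExt K) := by
  obtain ⟨C, hC0, hC⟩ := K.isBounded.exists_pos_norm_le
  refine ⟨C.toNNReal, LipschitzWith.of_le_add_mul _ fun x y => suppExt_le K fun z hz => ?_⟩
  have h1 := inner_le_suppExt K y hz
  have h2 : inner ℝ (x - y) z ≤ ‖x - y‖ * C :=
    (real_inner_le_norm _ _).trans (mul_le_mul_of_nonneg_left (hC z hz) (norm_nonneg _))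
  rw [inner_sub_left] at h2
  rw [dist_eq_norm, Real.coe_toNNReal _ hC0.le]
  linarith

lemma suppExt_comb (K L : ConvexBody (E n)) {s : ℝ} (hs : s ∈ Set.Icc (0 : ℝ) 1) (x : E n) :
    suppExt (comb K L s) x = (1 - s) * suppExt K x + s * suppExt L x := by
  have h1 : 0 ≤ 1 - s := by linarith [hs.2]
  have hmem : ∀ z, z ∈ (comb K L s : Set (E n)) ↔
      ∃ a ∈ (K : Set (E n)), ∃ b ∈ (L : Set (E n)), (1 - s) • a + s • b = z := by
    intro z
    simp only [comb, ConvexBody.coe_add, ConvexBody.coe_smul, Set.mem_add, Set.mem_smul_set]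
    aesop
  refine le_antisymm (suppExt_le _ fun z hz => ?_) ?_
  · obtain ⟨a, ha, b, hb, rfl⟩ := (hmem z).1 hz
    rw [inner_add_right, inner_smul_right, inner_smul_right]
    exact add_le_add (mul_le_mul_of_nonneg_left (inner_le_suppExt K x ha) h1)
      (mul_le_mul_of_nonneg_left (inner_le_suppExt L x hb) hs.1)
  · obtain ⟨a, ha, ea⟩ := exists_suppExt_eq K x
    obtain ⟨b, hb, eb⟩ := exists_suppExt_eq L x
    rw [ea, eb, ← inner_smul_right (𝕜 := ℝ), ← inner_smul_right (𝕜 := ℝ), ← inner_add_right]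
    exact inner_le_suppExt _ x ((hmem _).2 ⟨a, ha, b, hb, rfl⟩)

/-- A function on `ℝⁿ` that is Lipschitz and positively homogeneous of degree one. -/
structure IsHomLip (f : E n → ℝ) : Prop where
  lipschitz : ∃ C, LipschitzWith C f
  smul : ∀ (r : ℝ) (x : E n), 0 ≤ r → f (r • x) = r * f x

lemma isHomLip_suppExt (K : ConvexBody (E n)) : IsHomLip (suppExt K) :=
  ⟨exists_lipschitzWith_suppExt K, suppExt_smul K⟩

lemma IsHomLip.add_smul {f g : E n → ℝ} (hf : IsHomLip f) (hg : IsHomLip g) (a b : ℝ) :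
    IsHomLip (fun x => a * f x + b * g x) := by
  obtain ⟨C, hC⟩ := hf.lipschitz
  obtain ⟨D, hD⟩ := hg.lipschitz
  refine ⟨⟨‖a‖₊ * C + ‖b‖₊ * D, ?_⟩, fun r x hr => ?_⟩
  · exact ((lipschitzWith_smul a).comp hC).add ((lipschitzWith_smul b).comp hD)
  · rw [hf.smul r x hr, hg.smul r x hr]; ring

lemma IsHomLip.zero {f : E n → ℝ} (hf : IsHomLip f) : f 0 = 0 := by
  simpa using hf.smul 0 0 le_rfl

lemma IsHomLip.eq_of_eqOn_sphere {f g : E n → ℝ} (hf : IsHomLip f) (hg : IsHomLip g)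
    (h : ∀ u : S n, f u = g u) (x : E n) : f x = g x := by
  rcases eq_or_ne x 0 with rfl | hx
  · rw [hf.zero, hg.zero]
  · have hx' : ‖x‖ ≠ 0 := norm_ne_zero_iff.2 hx
    have e : x = ‖x‖ • (‖x‖⁻¹ • x) := by rw [smul_smul, mul_inv_cancel₀ hx', one_smul]
    rw [e, hf.smul _ _ (norm_nonneg x), hg.smul _ _ (norm_nonneg x)]
    have := h ⟨‖x‖⁻¹ • x, by simp [norm_smul, hx']⟩
    simp only at this
    rw [this]

lemma radialExt_restrict {f : E n → ℝ} (hf : IsHomLip f) (y : E n) :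
    radialExt (fun u : S n => f u) y = ‖y‖⁻¹ * f y := by
  rw [radialExt]
  split_ifs with h
  · simp [h]
  · exact hf.smul _ _ (by positivity)

lemma hasFDerivAt_norm_inv (u : E n) (hu : ‖u‖ = 1) :
    HasFDerivAt (fun y : E n => ‖y‖⁻¹) (-(innerSL ℝ u)) u := by
  have h1 : HasFDerivAt (fun y : E n => ‖y‖ ^ 2) (2 • innerSL ℝ u) u :=
    (hasStrictFDerivAt_norm_sq u).hasFDerivAt
  have h2 : HasDerivAt (fun t : ℝ => (√t)⁻¹) (-(1 / 2)) (‖u‖ ^ 2) := by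
    rw [hu]
    have h : HasDerivAt (fun t : ℝ => (√t)⁻¹) (-(1 / (2 * √(1 ^ 2))) / √(1 ^ 2) ^ 2) (1 ^ 2) :=
      (Real.hasDerivAt_sqrt (x := 1 ^ 2) (by norm_num)).inv (by norm_num)
    have e : -(1 / (2 * √((1 : ℝ) ^ 2))) / √(1 ^ 2) ^ 2 = -(1 / 2) := by norm_num
    rwa [e] at h
  have h3 := h2.comp_hasFDerivAt u h1
  have e : (fun y : E n => ‖y‖⁻¹) = (fun t : ℝ => (√t)⁻¹) ∘ fun y : E n => ‖y‖ ^ 2 := by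
    ext y; simp
  have e2 : -(innerSL ℝ u) = -(1 / 2 : ℝ) • 2 • innerSL ℝ u := by
    ext y
    simp
  rw [e, e2]
  exact h3

lemma inner_gradient_self {f : E n → ℝ} (hf : IsHomLip f) {x : E n}
    (hx : DifferentiableAt ℝ f x) : inner ℝ (gradient f x) x = f x := by
  rw [inner_gradient_left]
  have h1 : HasDerivAt (fun t : ℝ => f (t • x)) (fderiv ℝ f x x) 1 := by
    have h := HasFDerivAt.comp_hasDerivAt (f := fun t : ℝ => t • x) (f' := x) 1
      (by rw [one_smul]; exact hx.hasFDerivAt)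
      (by simpa using (hasDerivAt_id (1 : ℝ)).smul_const x)
    exact h
  have h2 : HasDerivAt (fun t : ℝ => f (t • x)) (f x) 1 := by
    have h : HasDerivAt (fun t : ℝ => t * f x) (f x) 1 := by
      simpa using (hasDerivAt_id (1 : ℝ)).mul_const (f x)
    refine h.congr_of_eventuallyEq ?_
    filter_upwards [lt_mem_nhds (zero_lt_one' ℝ)] with t ht
    exact hf.smul t x ht.le
  exact h1.unique h2

/-- Euler's relation identifies f(u)u as the radial part of the Euclidean gradient; the spherical
gradient is what remains. -/
lemma sphGrad_restrict {f : E n → ℝ} (hf : IsHomLip f) (u : S n)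
    (hx : DifferentiableAt ℝ f (u : E n)) :
    sphGrad (fun u : S n => f u) u = gradient f u - f u • (u : E n) := by
  have hu : ‖(u : E n)‖ = 1 := by simp
  have e : radialExt (fun u : S n => f u) = fun y => ‖y‖⁻¹ * f y :=
    funext (radialExt_restrict hf)
  rw [sphGrad, e]
  refine HasGradientAt.gradient ?_
  have h : HasFDerivAt (fun y : E n => ‖y‖⁻¹ * f y)
      (‖(u : E n)‖⁻¹ • fderiv ℝ f u + f u • -(innerSL ℝ (u : E n))) (u : E n) :=
    (hasFDerivAt_norm_inv (u : E n) hu).mul hx.hasFDerivAt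
  have e2 : (InnerProductSpace.toDual ℝ (E n)) (gradient f u - f u • (u : E n)) =
      ‖(u : E n)‖⁻¹ • fderiv ℝ f u + f u • -(innerSL ℝ (u : E n)) := by
    ext y
    rw [InnerProductSpace.toDual_apply_apply, inner_sub_left, inner_gradient_left,
      real_inner_smul_left, hu]
    simp [sub_eq_add_neg]
  rw [hasGradientAt_iff_hasFDerivAt, e2]
  exact h

lemma inner_sphGrad_restrict {f g : E n → ℝ} (hf : IsHomLip f) (hg : IsHomLip g) (u : S n)
    (hfu : DifferentiableAt ℝ f (u : E n)) (hgu : DifferentiableAt ℝ g (u : E n)) :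
    inner ℝ (sphGrad (fun u : S n => f u) u) (sphGrad (fun u : S n => g u) u) =
      inner ℝ (gradient f u) (gradient g u) - f u * g u := by
  have hu : inner ℝ (u : E n) (u : E n) = 1 := by simp
  rw [sphGrad_restrict hf u hfu, sphGrad_restrict hg u hgu, inner_sub_left, inner_sub_right,
    inner_sub_right, real_inner_smul_left, real_inner_smul_right, real_inner_smul_left,
    real_inner_smul_right, hu, inner_gradient_self hf hfu, real_inner_comm (gradient g u) (u : E n),
    inner_gradient_self hg hgu]
  ring

lemma gradient_smul {f : E n → ℝ} (hf : IsHomLip f) {r : ℝ} (hr : 0 < r) (x : E n) :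
    gradient f (r • x) = gradient f x := by
  have h : (fun y => f (r • y)) = r • f := funext fun y => hf.smul r y hr.le
  have h1 := fderiv_comp_smul (𝕜 := ℝ) (f := f) (x := x) r
  rw [h, fderiv_const_smul_field, Pi.smul_apply] at h1
  rw [gradient, gradient, smul_right_injective _ hr.ne' h1]

lemma differentiableAt_comp_smul_of_isHomLip {f : E n → ℝ} (hf : IsHomLip f) {r : ℝ} (hr : 0 < r) (x : E n)
    (h : DifferentiableAt ℝ f x) : DifferentiableAt ℝ f (r • x) := by
  have e : f = fun y => r * f (r⁻¹ • y) := funext fun y => by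
    rw [hf.smul _ _ (inv_pos.2 hr).le, ← mul_assoc, mul_inv_cancel₀ hr.ne', one_mul]
  rw [e]
  refine DifferentiableAt.const_mul ?_ _
  refine DifferentiableAt.comp (r • x) (g := f) (f := fun y => r⁻¹ • y) ?_ (by fun_prop)
  simpa [smul_smul, inv_mul_cancel₀ hr.ne'] using h

end SupportFunction

/-! ### Translation between the sphere and Gaussian space. -/

section Transfer

variable {n : ℕ}

lemma nontrivial_E (hn : 1 ≤ n) : Nontrivial (E n) := by
  have : Nonempty (Fin n) := ⟨⟨0, hn⟩⟩
  infer_instance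

theorem integral_eq_radialMoment_smul (hn : 1 ≤ n) {W : Type*} [NormedAddCommGroup W]
    [NormedSpace ℝ W] (F : E n → W) (k : ℕ)
    (hF : ∀ (r : ℝ) (x : E n), 0 < r → F (r • x) = r ^ k • F x) :
    ∫ x, F x ∂(stdGaussian (E n)) = radialMoment n k • ∫ u : S n, F u ∂(surf n) := by
  have := nontrivial_E hn
  have h := integral_stdGaussian_homogeneous F k hF
  rwa [finrank_euclideanSpace_fin] at h

/-- The set of non-differentiability is invariant under positive dilations and Gaussian-null. Polar
integration of its indicator, of degree 0, shows that its trace on the sphere is null. -/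
lemma ae_surf_differentiableAt (hn : 1 ≤ n) {f : E n → ℝ} (hf : IsHomLip f) :
    ∀ᵐ u : S n ∂(surf n), DifferentiableAt ℝ f (u : E n) := by
  classical
  obtain ⟨C, hC⟩ := hf.lipschitz
  set A : Set (E n) := {x | ¬ DifferentiableAt ℝ f x} with hA
  have hAm : MeasurableSet A := (measurableSet_of_differentiableAt ℝ f).compl
  have h := integral_eq_radialMoment_smul hn (A.indicator (fun _ => (1 : ℝ))) 0 (by
    intro r x hr
    have : r • x ∈ A ↔ x ∈ A := not_congr ⟨fun h => by
      simpa [smul_smul, inv_mul_cancel₀ hr.ne'] using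
        differentiableAt_comp_smul_of_isHomLip hf (inv_pos.2 hr) _ h, differentiableAt_comp_smul_of_isHomLip hf hr x⟩
    simp only [Set.indicator, this, pow_zero, one_smul])
  have h0 : ∫ x, A.indicator (fun _ => (1 : ℝ)) x ∂(stdGaussian (E n)) = 0 := by
    rw [integral_eq_zero_of_ae]
    filter_upwards [ae_differentiableAt_stdGaussian hC] with x hx
    exact Set.indicator_of_notMem (by simpa [hA] using hx) _
  rw [h0, smul_eq_mul, eq_comm, mul_eq_zero, or_iff_right (radialMoment_pos n 0 hn).ne'] at h
  have hB : MeasurableSet {u : S n | (u : E n) ∈ A} := measurable_subtype_coe hAm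
  have h2 : ∫ u : S n, ({u : S n | (u : E n) ∈ A}.indicator (1 : S n → ℝ)) u ∂(surf n) = 0 := h
  rw [integral_indicator_one hB, measureReal_eq_zero_iff] at h2
  rw [ae_iff]
  exact h2

lemma continuous_restrict {f : E n → ℝ} (hf : IsHomLip f) : Continuous fun u : S n => f u := by
  obtain ⟨C, hC⟩ := hf.lipschitz
  exact hC.continuous.comp continuous_subtype_val

theorem V2_eq_gaussForm (hn : 2 ≤ n) {f g : E n → ℝ} (hf : IsHomLip f) (hg : IsHomLip g) :
    V2 n (fun u => f u) (fun u => g u) =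
      (2 * kappa (n - 2) * radialMoment n 0)⁻¹ * gaussForm f g := by
  have hn1 : 1 ≤ n := by omega
  obtain ⟨C, hC⟩ := hf.lipschitz
  obtain ⟨D, hD⟩ := hg.lipschitz
  have e1 : ∫ x, f x * g x ∂(stdGaussian (E n)) =
      radialMoment n 2 * ∫ u : S n, f u * g u ∂(surf n) :=
    integral_eq_radialMoment_smul hn1 (fun x => f x * g x) 2 fun r x hr => by
      simp only [hf.smul r x hr.le, hg.smul r x hr.le, smul_eq_mul]; ring
  have e2 : ∫ x, inner ℝ (gradient f x) (gradient g x) ∂(stdGaussian (E n)) =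
      radialMoment n 0 * ∫ u : S n, inner ℝ (gradient f u) (gradient g u) ∂(surf n) :=
    integral_eq_radialMoment_smul hn1 (fun x => inner ℝ (gradient f x) (gradient g x)) 0
      fun r x hr => by simp only [gradient_smul hf hr, gradient_smul hg hr, pow_zero, one_smul]
  have i1 : Integrable (fun u : S n => f u * g u) (surf n) :=
    ((continuous_restrict hf).mul (continuous_restrict hg)).integrable_of_hasCompactSupport
      (HasCompactSupport.of_compactSpace _)
  have i2 : Integrable (fun u : S n => inner ℝ (gradient f u) (gradient g u)) (surf n) := by
    refine Integrable.of_bound (C := C * D) ?_ (ae_of_all _ fun u => ?_)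
    · exact (((measurable_gradient f).inner (measurable_gradient g)).comp
        measurable_subtype_coe).aestronglyMeasurable
    · exact (norm_inner_le_norm _ _).trans (mul_le_mul (norm_gradient_le hC _)
        (norm_gradient_le hD _) (norm_nonneg _) C.coe_nonneg)
  have e3 : ∫ u : S n, inner ℝ (sphGrad (fun u : S n => f u) u) (sphGrad (fun u : S n => g u) u)
      ∂(surf n) = ∫ u : S n, inner ℝ (gradient f u) (gradient g u) ∂(surf n) -
        ∫ u : S n, f u * g u ∂(surf n) := by
    rw [← integral_sub i2 i1]
    refine integral_congr_ae ?_
    filter_upwards [ae_surf_differentiableAt hn1 hf, ae_surf_differentiableAt hn1 hg] with u h1 h2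
    exact inner_sphGrad_restrict hf hg u h1 h2
  rw [V2, e3, gaussForm, e1, e2, radialMoment_two n hn1]
  have h1 := (kappa_pos (n - 2)).ne'
  have h2 := (radialMoment_pos n 0 hn1).ne'
  have h3 : (n : ℝ) - 1 ≠ 0 := by
    have : (2 : ℝ) ≤ n := by exact_mod_cast hn
    linarith
  field_simp
  ring

theorem V1_eq_integral (hn : 1 ≤ n) {f : E n → ℝ} (hf : IsHomLip f) :
    V1 n (fun u => f u) = (2 * π) ^ (1 / 2 : ℝ) * ∫ x, f x ∂(stdGaussian (E n)) := by
  have e1 : ∫ x, f x ∂(stdGaussian (E n)) = radialMoment n 1 * ∫ u : S n, f u ∂(surf n) :=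
    integral_eq_radialMoment_smul hn f 1 fun r x hr => by
      simp only [hf.smul r x hr.le, smul_eq_mul, pow_one]
  have h := kappa_mul_radialMoment_one n hn
  have h1 := (kappa_pos (n - 1)).ne'
  have h2 : (2 * π) ^ (1 / 2 : ℝ) * (kappa (n - 1) * radialMoment n 1) = 1 := by
    rw [h, ← Real.rpow_add (by positivity)]; simp
  rw [V1, e1, inv_mul_eq_iff_eq_mul₀ h1]
  calc _ = ((2 * π) ^ (1 / 2 : ℝ) * (kappa (n - 1) * radialMoment n 1)) *
        ∫ u : S n, f u ∂(surf n) := by rw [h2, one_mul]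
    _ = _ := by ring

theorem steinerPoint_eq_zero_iff (hn : 1 ≤ n) (K : ConvexBody (E n)) :
    steinerPoint K = 0 ↔
      ∀ v : E n, ∫ x, inner ℝ v x * suppExt K x ∂(stdGaussian (E n)) = 0 := by
  have i1 : Integrable (fun u : S n => suppExt K u • (u : E n)) (surf n) :=
    ((continuous_restrict (isHomLip_suppExt K)).smul
      continuous_subtype_val).integrable_of_hasCompactSupport (HasCompactSupport.of_compactSpace _)
  have e1 : ∀ v : E n, ∫ x, inner ℝ v x * suppExt K x ∂(stdGaussian (E n)) =
      radialMoment n 2 * inner ℝ v (∫ u : S n, suppExt K u • (u : E n) ∂(surf n)) := by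
    intro v
    rw [integral_eq_radialMoment_smul hn (fun x => inner ℝ v x * suppExt K x) 2 fun r x hr => by
      rw [suppExt_smul K r x hr.le, real_inner_smul_right, smul_eq_mul]; ring]
    rw [smul_eq_mul, ← integral_inner i1]
    simp_rw [real_inner_smul_right, mul_comm]
  have hk : steinerPoint K = 0 ↔ ∫ u : S n, suppExt K u • (u : E n) ∂(surf n) = 0 := by
    rw [steinerPoint, smul_eq_zero, or_iff_right (inv_pos.2 (kappa_pos n)).ne']
    rfl
  simp_rw [hk, e1, mul_eq_zero, or_iff_right (radialMoment_pos n 2 hn).ne']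
  exact ⟨fun h v => by rw [h, inner_zero_right], fun h => inner_self_eq_zero.1 (h _)⟩

/-- Normalization of a function, in terms of Gaussian integrals. -/
def IsNormalizedFun (f : E n → ℝ) : Prop :=
  (∀ v : E n, ∫ x, inner ℝ v x * f x ∂(stdGaussian (E n)) = 0) ∧
    (2 * π) ^ (1 / 2 : ℝ) * ∫ x, f x ∂(stdGaussian (E n)) = 1

theorem isNormalized_iff (hn : 1 ≤ n) (K : ConvexBody (E n)) :
    IsNormalized K ↔ IsNormalizedFun (suppExt K) := by
  rw [IsNormalized, IsNormalizedFun, steinerPoint_eq_zero_iff hn,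
    ← V1_eq_integral hn (isHomLip_suppExt K)]
  rfl

lemma IsHomLip.integrable {f : E n → ℝ} (hf : IsHomLip f) : Integrable f (stdGaussian (E n)) := by
  obtain ⟨C, hC⟩ := hf.lipschitz
  exact (LipschitzWith.memLp_stdGaussian hC).integrable (by norm_num)

lemma IsHomLip.integrable_inner_mul {f : E n → ℝ} (hf : IsHomLip f) (v : E n) :
    Integrable (fun x => inner ℝ v x * f x) (stdGaussian (E n)) := by
  obtain ⟨C, hC⟩ := hf.lipschitz
  exact (LipschitzWith.memLp_stdGaussian (innerSL ℝ v).lipschitz).integrable_mul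
    (LipschitzWith.memLp_stdGaussian hC)

lemma IsHomLip.integral_add_smul {f g : E n → ℝ} (hf : IsHomLip f) (hg : IsHomLip g) (a b : ℝ) :
    ∫ x, (a * f x + b * g x) ∂(stdGaussian (E n)) =
      a * ∫ x, f x ∂(stdGaussian (E n)) + b * ∫ x, g x ∂(stdGaussian (E n)) := by
  rw [integral_add (hf.integrable.const_mul a) (hg.integrable.const_mul b), integral_const_mul,
    integral_const_mul]

lemma IsHomLip.integral_inner_add_smul {f g : E n → ℝ} (hf : IsHomLip f) (hg : IsHomLip g)
    (a b : ℝ) (v : E n) :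
    ∫ x, inner ℝ v x * (a * f x + b * g x) ∂(stdGaussian (E n)) =
      a * ∫ x, inner ℝ v x * f x ∂(stdGaussian (E n)) +
        b * ∫ x, inner ℝ v x * g x ∂(stdGaussian (E n)) := by
  rw [← integral_const_mul, ← integral_const_mul, ← integral_add
    ((hf.integrable_inner_mul v).const_mul a) ((hg.integrable_inner_mul v).const_mul b)]
  congr 1 with x
  ring

lemma IsNormalizedFun.add_smul {f g : E n → ℝ} (hf : IsHomLip f) (hg : IsHomLip g)
    (hfn : IsNormalizedFun f) (hgn : IsNormalizedFun g) {a b : ℝ} (hab : a + b = 1) :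
    IsNormalizedFun (fun x => a * f x + b * g x) := by
  refine ⟨fun v => ?_, ?_⟩
  · rw [hf.integral_inner_add_smul hg, hfn.1, hgn.1]; ring
  · rw [hf.integral_add_smul hg, mul_add, mul_left_comm, hfn.2, mul_left_comm, hgn.2]
    linarith

lemma suppExt_comb_fun (K L : ConvexBody (E n)) {s : ℝ} (hs : s ∈ Set.Icc (0 : ℝ) 1) :
    suppExt (comb K L s) = fun x => (1 - s) * suppExt K x + s * suppExt L x :=
  funext (suppExt_comb K L hs)

lemma isNormalized_comb (hn : 1 ≤ n) {K L : ConvexBody (E n)} (hK : IsNormalized K)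
    (hL : IsNormalized L) {s : ℝ} (hs : s ∈ Set.Icc (0 : ℝ) 1) : IsNormalized (comb K L s) := by
  rw [isNormalized_iff hn] at *
  rw [suppExt_comb_fun K L hs]
  exact IsNormalizedFun.add_smul (isHomLip_suppExt K) (isHomLip_suppExt L) hK hL (by ring)

end Transfer

/-! ### Non-degenerate bodies and positivity of the form. -/

section Triangle

variable {n : ℕ}

/-- The set contains the vertices of a non-degenerate triangle. -/
def HasTriangle (M : Set (E n)) : Prop :=
  ∃ c a b : E n, c ∈ M ∧ c + a ∈ M ∧ c + b ∈ M ∧ a ≠ 0 ∧ ∀ s : ℝ, b ≠ s • a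

lemma HasTriangle.not_isPointOrSegment {M : ConvexBody (E n)}
    (h : HasTriangle (M : Set (E n))) : ¬ IsPointOrSegment M := by
  rintro ⟨x, y, hM⟩
  obtain ⟨c, a, b, hc, ha, hb, ha0, hab⟩ := h
  rw [hM, segment_eq_image'] at hc ha hb
  obtain ⟨t₀, -, h0⟩ := hc
  obtain ⟨t₁, -, h1⟩ := ha
  obtain ⟨t₂, -, h2⟩ := hb
  simp only at h0 h1 h2
  have e1 : a = (t₁ - t₀) • (y - x) := by
    rw [sub_smul, ← add_sub_cancel_left c a, ← h1, ← h0]; abel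
  have e2 : b = (t₂ - t₀) • (y - x) := by
    rw [sub_smul, ← add_sub_cancel_left c b, ← h2, ← h0]; abel
  have h3 : t₁ - t₀ ≠ 0 := by
    intro h; rw [h, zero_smul] at e1; exact ha0 e1
  exact hab ((t₂ - t₀) / (t₁ - t₀)) (by rw [e1, smul_smul, div_mul_cancel₀ _ h3, ← e2])

/-- Without a triangle all points lie on one line, and the body is the segment between the extrema
of a linear functional along it. -/
lemma hasTriangle_of_not_isPointOrSegment {M : ConvexBody (E n)} (h : ¬ IsPointOrSegment M) :
    HasTriangle (M : Set (E n)) := by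
  by_contra hT
  obtain ⟨c, hc⟩ := M.nonempty
  by_cases hd : ∃ d ∈ (M : Set (E n)), d ≠ c
  · obtain ⟨d, hd, hdc⟩ := hd
    set a := d - c with ha
    have ha0 : a ≠ 0 := sub_ne_zero.2 hdc
    have hline : ∀ y ∈ (M : Set (E n)), ∃ t : ℝ, y = c + t • a := by
      intro y hy
      by_contra! hne
      exact hT ⟨c, a, y - c, hc, by simpa [ha] using hd, by simpa using hy, ha0,
        fun s hs => hne s (by rw [← hs]; abel)⟩
    have hcont : ContinuousOn (fun y : E n => inner ℝ a y) (M : Set (E n)) := by fun_prop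
    obtain ⟨y₀, hy₀, hmin⟩ := M.isCompact.exists_isMinOn M.nonempty hcont
    obtain ⟨y₁, hy₁, hmax⟩ := M.isCompact.exists_isMaxOn M.nonempty hcont
    refine h ⟨y₀, y₁, Set.Subset.antisymm (fun y hy => ?_) (M.convex.segment_subset hy₀ hy₁)⟩
    have h0 := hmin hy
    have h1 := hmax hy
    obtain ⟨t₀, rfl⟩ := hline y₀ hy₀
    obtain ⟨t₁, rfl⟩ := hline y₁ hy₁
    obtain ⟨t, rfl⟩ := hline y hy
    have hpos : 0 < inner ℝ a a := real_inner_self_pos.2 ha0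
    simp only [Set.mem_ofPred_eq, inner_add_right, real_inner_smul_right, add_le_add_iff_left,
      mul_le_mul_iff_left₀ hpos] at h0 h1
    rw [segment_eq_image']
    rcases eq_or_lt_of_le (h0.trans h1) with h01 | h01
    · have : t = t₀ := by linarith
      exact ⟨0, by simp, by simp [this]⟩
    · have h2 : 0 < t₁ - t₀ := sub_pos.2 h01
      refine ⟨(t - t₀) / (t₁ - t₀), ⟨div_nonneg (by linarith) h2.le, ?_⟩, ?_⟩
      · rw [div_le_one h2]; linarith
      · simp only
        rw [add_sub_add_left_eq_sub, ← sub_smul, smul_smul, div_mul_cancel₀ _ h2.ne', sub_smul]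
        abel
  · push Not at hd
    refine h ⟨c, c, ?_⟩
    rw [segment_same]
    exact Set.eq_singleton_iff_unique_mem.2 ⟨hc, hd⟩

lemma mem_comb {K L : ConvexBody (E n)} {s : ℝ} {x y : E n} (hx : x ∈ (K : Set (E n)))
    (hy : y ∈ (L : Set (E n))) : (1 - s) • x + s • y ∈ (comb K L s : Set (E n)) :=
  Set.add_mem_add (Set.smul_mem_smul_set hx) (Set.smul_mem_smul_set hy)

lemma HasTriangle.comb_left {K L : ConvexBody (E n)} (h : HasTriangle (K : Set (E n))) {s : ℝ}
    (hs : s ≠ 1) : HasTriangle (comb K L s : Set (E n)) := by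
  obtain ⟨c, a, b, hc, ha, hb, ha0, hab⟩ := h
  obtain ⟨y, hy⟩ := L.nonempty
  have h1 : 1 - s ≠ 0 := sub_ne_zero.2 hs.symm
  refine ⟨(1 - s) • c + s • y, (1 - s) • a, (1 - s) • b, mem_comb hc hy, ?_, ?_,
    smul_ne_zero h1 ha0, fun t ht => hab t ?_⟩
  · convert mem_comb (s := s) ha hy using 1; module
  · convert mem_comb (s := s) hb hy using 1; module
  · rw [smul_comm] at ht
    exact smul_right_injective _ h1 ht

lemma HasTriangle.comb_right {K L : ConvexBody (E n)} (h : HasTriangle (L : Set (E n))) :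
    HasTriangle (comb K L 1 : Set (E n)) := by
  obtain ⟨c, a, b, hc, ha, hb, ha0, hab⟩ := h
  obtain ⟨y, hy⟩ := K.nonempty
  have key : ∀ z ∈ (L : Set (E n)), z ∈ (comb K L 1 : Set (E n)) := fun z hz => by
    simpa using mem_comb (s := 1) hy hz
  exact ⟨c, a, b, key _ hc, key _ ha, key _ hb, ha0, hab⟩

/-- The linear map `x ↦ (⟨a, x⟩, ⟨b, x⟩)`. -/
noncomputable def innerPair (a b : E n) : E n →L[ℝ] E 2 :=
  LinearMap.toContinuousLinearMap
    { toFun := fun x => !₂[inner ℝ a x, inner ℝ b x]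
      map_add' := fun x y => by ext i; fin_cases i <;> simp [inner_add_right]
      map_smul' := fun r x => by ext i; fin_cases i <;> simp [inner_smul_right] }

lemma norm_innerPair_sq (a b x : E n) :
    ‖innerPair a b x‖ ^ 2 = inner ℝ a x ^ 2 + inner ℝ b x ^ 2 := by
  rw [EuclideanSpace.real_norm_sq_eq, Fin.sum_univ_two]
  rfl

lemma isHomLip_norm_comp {m : ℕ} (T : E n →L[ℝ] E m) : IsHomLip fun x => ‖T x‖ :=
  ⟨⟨_, lipschitzWith_one_norm.comp T.lipschitz⟩, fun r x hr => by
    rw [map_smul, norm_smul, Real.norm_of_nonneg hr]⟩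

lemma isHomLip_inner (v : E n) : IsHomLip fun x => inner ℝ v x :=
  ⟨⟨_, (innerSL ℝ v).lipschitz⟩, fun r x _ => real_inner_smul_right v x r⟩

/-- Off the zero set the gradient is (Aa + Bb)/N with N² = A² + B², and |Aa + Bb|² + |Ba − Ab|² =
N²(|a|² + |b|²). Linear independence makes the second square positive. -/
lemma norm_gradient_norm_innerPair_lt {a b : E n} (ha : a ≠ 0) (hab : ∀ s : ℝ, b ≠ s • a)
    (x : E n) : ‖gradient (fun x => ‖innerPair a b x‖) x‖ ^ 2 < ‖a‖ ^ 2 + ‖b‖ ^ 2 := by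
  have hpos : 0 < ‖a‖ ^ 2 + ‖b‖ ^ 2 := by
    have := norm_pos_iff.2 ha
    positivity
  set A := inner ℝ a x with hA
  set B := inner ℝ b x with hB
  have hN := norm_innerPair_sq a b x
  rw [← hA, ← hB] at hN
  rcases eq_or_ne ‖innerPair a b x‖ 0 with h0 | h0
  · have hmin : IsLocalMin (fun x => ‖innerPair a b x‖) x :=
      Eventually.of_forall fun y => by simp only [h0]; positivity
    have : gradient (fun x => ‖innerPair a b x‖) x = 0 := by
      rw [gradient, hmin.fderiv_eq_zero, map_zero]
    rw [this]
    simpa using hpos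
  · set N := ‖innerPair a b x‖
    have hNpos : 0 < N ^ 2 := by positivity
    have hN' : 0 < A ^ 2 + B ^ 2 := by rw [← hN]; positivity
    have e : (fun x => ‖innerPair a b x‖) = fun x => √(inner ℝ a x ^ 2 + inner ℝ b x ^ 2) := by
      ext y
      rw [← norm_innerPair_sq, Real.sqrt_sq (norm_nonneg _)]
    have hNs : N = √(A ^ 2 + B ^ 2) := congrFun e x
    have hd : HasGradientAt (fun x => ‖innerPair a b x‖) ((1 / N) • (A • a + B • b)) x := by
      rw [hasGradientAt_iff_hasFDerivAt, e]
      have d1 : HasFDerivAt (fun x => inner ℝ a x) (innerSL ℝ a) x := (innerSL ℝ a).hasFDerivAt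
      have d2 : HasFDerivAt (fun x => inner ℝ b x) (innerSL ℝ b) x := (innerSL ℝ b).hasFDerivAt
      have d3 := ((d1.pow 2).add (d2.pow 2)).sqrt (by exact hN'.ne')
      have e2 : (InnerProductSpace.toDual ℝ (E n)) ((1 / N) • (A • a + B • b)) =
          (1 / (2 * √(A ^ 2 + B ^ 2))) • (((2 : ℕ) • A ^ (2 - 1)) • innerSL ℝ a +
            ((2 : ℕ) • B ^ (2 - 1)) • innerSL ℝ b) := by
        ext y
        rw [← hNs, InnerProductSpace.toDual_apply_apply]
        simp [inner_add_left, real_inner_smul_left]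
        field_simp
      rw [e2]
      exact d3
    rw [hd.gradient, norm_smul, mul_pow, norm_div, div_pow, norm_one, one_pow,
      Real.norm_eq_abs, sq_abs, one_div_mul_eq_div, div_lt_iff₀ hNpos, hN]
    have h1 : 0 < ‖B • a - A • b‖ ^ 2 := by
      have : B • a - A • b ≠ 0 := by
        intro h
        rw [sub_eq_zero] at h
        rcases eq_or_ne A 0 with hA0 | hA0
        · rw [hA0, zero_smul, smul_eq_zero, or_iff_left ha] at h
          rw [hA0, h] at hN'
          norm_num at hN'
        · refine hab (B / A) ?_
          rw [div_eq_inv_mul, mul_smul, h, smul_smul, inv_mul_cancel₀ hA0, one_smul]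
      have := norm_pos_iff.2 this
      positivity
    rw [norm_sub_sq_real, norm_smul, norm_smul, mul_pow, mul_pow, real_inner_smul_left,
      real_inner_smul_right, Real.norm_eq_abs, Real.norm_eq_abs, sq_abs, sq_abs] at h1
    rw [norm_add_sq_real, norm_smul, norm_smul, mul_pow, mul_pow, real_inner_smul_left,
      real_inner_smul_right, Real.norm_eq_abs, Real.norm_eq_abs, sq_abs, sq_abs]
    nlinarith

/-- The mean of N² is |a|² + |b|², which strictly exceeds |∇N|² at every point. -/
lemma gaussForm_norm_innerPair_pos {a b : E n} (ha : a ≠ 0) (hab : ∀ s : ℝ, b ≠ s • a) :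
    0 < gaussForm (fun x => ‖innerPair a b x‖) (fun x => ‖innerPair a b x‖) := by
  obtain ⟨C, hC⟩ := (isHomLip_norm_comp (innerPair a b)).lipschitz
  have e1 : ∫ x, ‖innerPair a b x‖ * ‖innerPair a b x‖ ∂(stdGaussian (E n)) =
      ∫ _x, (‖a‖ ^ 2 + ‖b‖ ^ 2) ∂(stdGaussian (E n)) := by
    simp_rw [← sq, norm_innerPair_sq, sq (inner ℝ _ _)]
    have i : ∀ v : E n, Integrable (fun x => inner ℝ v x * inner ℝ v x) (stdGaussian (E n)) :=
      fun v => (isHomLip_inner v).integrable_inner_mul v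
    rw [integral_add (i a) (i b), integral_inner_mul_inner_stdGaussian,
      integral_inner_mul_inner_stdGaussian]
    simp
  have i2 := MemLp.integrable_inner (memLp_gradient hC) (memLp_gradient hC)
  rw [gaussForm, e1, ← integral_sub (integrable_const _) i2]
  have hlt : ∀ x : E n, 0 < ‖a‖ ^ 2 + ‖b‖ ^ 2 - inner ℝ
      (gradient (fun x => ‖innerPair a b x‖) x) (gradient (fun x => ‖innerPair a b x‖) x) := by
    intro x
    rw [real_inner_self_eq_norm_sq]
    exact sub_pos.2 (norm_gradient_norm_innerPair_lt ha hab x)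
  rw [integral_pos_iff_support_of_nonneg (fun x => (hlt x).le) ((integrable_const _).sub i2)]
  have : Function.support (fun x : E n => ‖a‖ ^ 2 + ‖b‖ ^ 2 - inner ℝ
      (gradient (fun x => ‖innerPair a b x‖) x) (gradient (fun x => ‖innerPair a b x‖) x)) =
      Set.univ := Set.eq_univ_of_forall fun x => (hlt x).ne'
  rw [this, measure_univ]
  norm_num

/-- A small ellipse about the centroid of a triangle lies inside the triangle; 1/10 is just a small
enough size. -/
lemma triangle_bound (A B m N : ℝ) (h0 : 0 ≤ m) (hA : A ≤ m) (hB : B ≤ m)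
    (hN : N ^ 2 = A ^ 2 + B ^ 2) : (A + B) / 3 + 1 / 10 * N ≤ m := by
  have h1 : N ≤ |A| + |B| := by
    refine abs_le_of_sq_le_sq' ?_ (by positivity) |>.2
    rw [hN, add_sq, sq_abs, sq_abs]
    nlinarith [abs_nonneg A, abs_nonneg B]
  rcases abs_cases A with ⟨e1, _⟩ | ⟨e1, _⟩ <;> rcases abs_cases B with ⟨e2, _⟩ | ⟨e2, _⟩ <;>
    linarith

/-- With H the support function and N that of a centred ellipse, H dominates a linear function plus
N/10. Pairing the nonnegative difference with H and then with N gives Q(H,H) ≥ Q(N,H)/10 ≥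
Q(N,N)/100 > 0, as linear functions drop out of the form Q. -/
theorem gaussForm_suppExt_pos {K : ConvexBody (E n)} (h : HasTriangle (K : Set (E n))) :
    0 < gaussForm (suppExt K) (suppExt K) := by
  obtain ⟨c, a, b, hc, ha, hb, ha0, hab⟩ := h
  set H := suppExt K with hH
  set N : E n → ℝ := fun x => ‖innerPair a b x‖ with hNdef
  have hHl : IsHomLip H := isHomLip_suppExt K
  have hNl : IsHomLip N := isHomLip_norm_comp _
  -- The centroid of the triangle.
  set w : E n := c + (1 / 3 : ℝ) • (a + b) with hw
  have hWl : IsHomLip fun x => inner ℝ w x := isHomLip_inner w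
  set D : E n → ℝ := fun x => 1 * inner ℝ w x + (1 / 10) * N x with hD
  have hDl : IsHomLip D := hWl.add_smul hNl _ _
  have hle : ∀ x, D x ≤ H x := by
    intro x
    have h1 := inner_le_suppExt K x hc
    have h2 := inner_le_suppExt K x ha
    have h3 := inner_le_suppExt K x hb
    rw [inner_add_right] at h2 h3
    have := triangle_bound (inner ℝ a x) (inner ℝ b x) (H x - inner ℝ x c) (N x) (by linarith)
      (by rw [real_inner_comm]; linarith) (by rw [real_inner_comm]; linarith)
      (norm_innerPair_sq a b x)
    simp only [hD, hw, inner_add_left, real_inner_smul_left, real_inner_comm c x] at this ⊢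
    linarith
  set G : E n → ℝ := fun x => 1 * H x + (-1) * D x with hG
  have hGl : IsHomLip G := hHl.add_smul hDl _ _
  have hG0 : ∀ x, 0 ≤ G x := fun x => by
    have := hle x
    simp only [hG]
    linarith
  obtain ⟨CH, hCH⟩ := hHl.lipschitz
  obtain ⟨CN, hCN⟩ := hNl.lipschitz
  obtain ⟨CD, hCD⟩ := hDl.lipschitz
  obtain ⟨CG, hCG⟩ := hGl.lipschitz
  obtain ⟨CW, hCW⟩ := hWl.lipschitz
  have q1 : 0 ≤ gaussForm G H :=
    gaussForm_nonneg hCG hCH hG0 (suppExt_add_le K) (suppExt_smul K)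
  have q2 : 0 ≤ gaussForm G N :=
    gaussForm_nonneg hCG hCN hG0 (fun x y => by simp only [hNdef, map_add]; exact norm_add_le _ _)
      hNl.smul
  rw [gaussForm_add_smul hCH hCD hCH, gaussForm_add_smul hCW hCN hCH,
    gaussForm_inner_left hCH] at q1
  rw [gaussForm_add_smul hCH hCD hCN, gaussForm_add_smul hCW hCN hCN,
    gaussForm_inner_left hCN, gaussForm_comm H N] at q2
  have q3 := gaussForm_norm_innerPair_pos ha0 hab
  linarith

end Triangle

/-! ### Embedded balls and the kink argument. -/

section EmbeddedBall

variable {n p : ℕ}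

/-- The image of the ball of radius `r` under a linear isometric embedding. -/
noncomputable def embeddedBall (i : E p →ₗᵢ[ℝ] E n) (r : ℝ) (hr : 0 ≤ r) : ConvexBody (E n) where
  carrier := i '' Metric.closedBall 0 r
  convex' := (convex_closedBall 0 r).is_linear_image i.toLinearMap.isLinear
  isCompact' := (isCompact_closedBall 0 r).image i.continuous
  nonempty' := (Metric.nonempty_closedBall.2 hr).image _

lemma suppExt_embeddedBall (i : E p →ₗᵢ[ℝ] E n) {r : ℝ} (hr : 0 ≤ r) (x : E n) :
    suppExt (embeddedBall i r hr) x =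
      r * ‖ContinuousLinearMap.adjoint i.toContinuousLinearMap x‖ := by
  set y := ContinuousLinearMap.adjoint i.toContinuousLinearMap x with hy
  have key : ∀ z : E p, inner ℝ x (i z) = inner ℝ y z := fun z => by
    rw [hy, ContinuousLinearMap.adjoint_inner_left]; rfl
  refine le_antisymm (suppExt_le _ fun z hz => ?_) ?_
  · obtain ⟨z, hz, rfl⟩ := hz
    rw [mem_closedBall_zero_iff] at hz
    rw [key, mul_comm]
    exact (real_inner_le_norm _ _).trans (mul_le_mul_of_nonneg_left hz (norm_nonneg _))
  · rcases eq_or_ne y 0 with h0 | h0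
    · have h := inner_le_suppExt (embeddedBall i r hr) x
        (y := i 0) ⟨0, by simpa using hr, rfl⟩
      simpa [h0] using h
    · have hn : ‖y‖ ≠ 0 := norm_ne_zero_iff.2 h0
      have h := inner_le_suppExt (embeddedBall i r hr) x (y := i ((r / ‖y‖) • y))
        ⟨(r / ‖y‖) • y, by
          rw [mem_closedBall_zero_iff, norm_smul, norm_div, norm_norm, Real.norm_of_nonneg hr,
            div_mul_cancel₀ _ hn], rfl⟩
      rw [key, real_inner_smul_right, real_inner_self_eq_norm_sq] at h
      have e : r * ‖y‖ = r / ‖y‖ * ‖y‖ ^ 2 := by rw [sq, ← mul_assoc, div_mul_cancel₀ _ hn]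
      rwa [e]

/-- Orthogonal projections of a standard Gaussian are standard Gaussian, so means over ℝⁿ of
functions of the projection reduce to ℝᵖ. -/
lemma map_adjoint_stdGaussian (i : E p →ₗᵢ[ℝ] E n) :
    (stdGaussian (E n)).map (ContinuousLinearMap.adjoint i.toContinuousLinearMap) =
      stdGaussian (E p) := by
  have hm : Measurable (ContinuousLinearMap.adjoint i.toContinuousLinearMap) :=
    (ContinuousLinearMap.adjoint i.toContinuousLinearMap).continuous.measurable
  have : IsProbabilityMeasure ((stdGaussian (E n)).map
    (ContinuousLinearMap.adjoint i.toContinuousLinearMap)) :=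
    Measure.isProbabilityMeasure_map hm.aemeasurable
  apply Measure.ext_of_charFun
  ext t
  have h := charFun_stdGaussian (E := E n) (i t)
  rw [i.norm_map, ← charFun_stdGaussian (E := E p) t] at h
  rw [← h, charFun_apply, charFun_apply, integral_map hm.aemeasurable
    (Measurable.aestronglyMeasurable (by fun_prop))]
  refine integral_congr_ae (ae_of_all _ fun x => ?_)
  simp only
  rw [ContinuousLinearMap.adjoint_inner_left]
  rfl

lemma integral_norm_stdGaussian (hp : 1 ≤ p) :
    ∫ x, ‖x‖ ∂(stdGaussian (E p)) = radialMoment p 1 * (p * kappa p) := by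
  have := nontrivial_E hp
  rw [integral_eq_radialMoment_smul hp (fun x : E p => ‖x‖) 1 fun r x hr => by
    rw [norm_smul, Real.norm_of_nonneg hr.le, pow_one, smul_eq_mul]]
  simp only [norm_eq_of_mem_sphere, integral_const, smul_eq_mul, mul_one]
  rw [surf, Measure.toSphere_real_apply_univ, finrank_euclideanSpace_fin, kappa, Measure.real,
    Measure.real, Measure.addHaar_closedBall_eq_addHaar_ball]

/-- The radius `κ_{p-1} / (p κ_p)`. -/
noncomputable def ballRadius (p : ℕ) : ℝ := kappa (p - 1) / (p * kappa p)

lemma ballRadius_pos (hp : 1 ≤ p) : 0 < ballRadius p := by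
  have h1 := kappa_pos (p - 1)
  have h2 := kappa_pos p
  have h3 : (0 : ℝ) < p := by exact_mod_cast hp
  unfold ballRadius
  positivity

/-- Central symmetry annihilates the correlations with linear functions; projecting to ℝᵖ computes
the mean, and the radius is chosen to make `V1` equal to 1. -/
theorem isNormalized_embeddedBall (hp : 1 ≤ p) (hn : 1 ≤ n) (i : E p →ₗᵢ[ℝ] E n) :
    IsNormalized (embeddedBall i (ballRadius p) (ballRadius_pos hp).le) := by
  rw [isNormalized_iff hn]
  set T := ContinuousLinearMap.adjoint i.toContinuousLinearMap with hT
  have e : suppExt (embeddedBall i (ballRadius p) (ballRadius_pos hp).le) =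
      fun x => ballRadius p * ‖T x‖ := funext (suppExt_embeddedBall i _)
  rw [e]
  refine ⟨fun v => ?_, ?_⟩
  · have hneg : MeasurePreserving (LinearIsometryEquiv.neg ℝ : E n ≃ₗᵢ[ℝ] E n)
        (stdGaussian (E n)) (stdGaussian (E n)) :=
      ⟨(LinearIsometryEquiv.neg ℝ (E := E n)).continuous.measurable,
        stdGaussian_map (LinearIsometryEquiv.neg ℝ (E := E n))⟩
    have h := hneg.integral_comp (LinearIsometryEquiv.neg ℝ
      (E := E n)).toHomeomorph.measurableEmbedding fun x => inner ℝ v x * (ballRadius p * ‖T x‖)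
    simp only [LinearIsometryEquiv.coe_neg, inner_neg_right, map_neg, norm_neg, neg_mul,
      integral_neg] at h
    linarith
  · have h1 : ∫ x, ‖T x‖ ∂(stdGaussian (E n)) = ∫ y, ‖y‖ ∂(stdGaussian (E p)) := by
      rw [← map_adjoint_stdGaussian i, integral_map T.continuous.measurable.aemeasurable
        (Measurable.aestronglyMeasurable (by fun_prop))]
    have h2 := kappa_mul_radialMoment_one p hp
    have h3 : (2 * π) ^ (1 / 2 : ℝ) * (kappa (p - 1) * radialMoment p 1) = 1 := by
      rw [h2, ← Real.rpow_add (by positivity)]; simp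
    refine Eq.trans ?_ h3
    rw [integral_const_mul, h1, integral_norm_stdGaussian hp, ballRadius]
    have h4 := (kappa_pos p).ne'
    have h5 : (p : ℝ) ≠ 0 := by positivity
    field_simp

lemma hasTriangle_embeddedBall (hp : 2 ≤ p) (i : E p →ₗᵢ[ℝ] E n) {r : ℝ} (hr : 0 < r) :
    HasTriangle (embeddedBall i r hr.le : Set (E n)) := by
  set e₀ : E p := EuclideanSpace.single ⟨0, by omega⟩ r with he₀
  set e₁ : E p := EuclideanSpace.single ⟨1, by omega⟩ r with he₁
  refine ⟨0, i e₀, i e₁, ⟨0, by simpa using hr.le, map_zero i⟩,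
    ⟨e₀, by simp [he₀, abs_of_pos hr], (zero_add _).symm⟩,
    ⟨e₁, by simp [he₁, abs_of_pos hr], (zero_add _).symm⟩, fun h => ?_, fun s h => ?_⟩
  · rw [← map_zero i] at h
    have := congrArg (fun z : E p => z ⟨0, by omega⟩) (i.injective h)
    simp [he₀] at this
    exact hr.ne' this
  · rw [← map_smul] at h
    have := congrArg (fun z : E p => z ⟨1, by omega⟩) (i.injective h)
    simp [he₀, he₁] at this
    exact hr.ne' this

/-- The hyperplane orthogonal to v has dimension n − 1 ≥ p, so p vectors of an orthonormal basis of
it define the embedding. -/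
lemma exists_isometry_orthogonal (hpn : p < n) (v : E n) (hv : v ≠ 0) :
    ∃ i : E p →ₗᵢ[ℝ] E n, ∀ z, inner ℝ v (i z) = 0 := by
  have hfin : Module.finrank ℝ (ℝ ∙ v)ᗮ = n - 1 := by
    have h1 := Submodule.finrank_add_finrank_orthogonal (ℝ ∙ v)
    rw [finrank_span_singleton hv, finrank_euclideanSpace_fin] at h1
    omega
  let b := (stdOrthonormalBasis ℝ (ℝ ∙ v)ᗮ)
  let w : Fin p → E n := fun j => b (Fin.castLE (by omega) j)
  have hw : Orthonormal ℝ w :=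
    (b.orthonormal.comp (Fin.castLE (by omega)) (Fin.castLE_injective _)).comp_linearIsometry
      (Submodule.subtypeₗᵢ _)
  let B := (EuclideanSpace.basisFun (Fin p) ℝ)
  let f : E p →ₗ[ℝ] E n := B.toBasis.constr ℝ w
  have hf : ∀ j, f (B.toBasis j) = w j := fun j => B.toBasis.constr_basis ℝ w j
  refine ⟨f.isometryOfOrthonormal (v := B.toBasis) (by simp [B.orthonormal]) (by
    have : f ∘ B.toBasis = w := funext hf
    rwa [this]), fun z => ?_⟩
  change (innerₛₗ ℝ v) (f z) = 0
  have : (innerₛₗ ℝ v).comp f = 0 := B.toBasis.ext fun j => by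
    rw [LinearMap.comp_apply, hf]
    exact (b (Fin.castLE (by omega) j)).2 v (Submodule.mem_span_singleton_self v)
  exact LinearMap.congr_fun this z

lemma exists_differentiableAt_suppExt (hn : 1 ≤ n) (K : ConvexBody (E n)) :
    ∃ v : E n, v ≠ 0 ∧ DifferentiableAt ℝ (suppExt K) v := by
  have := nontrivial_E hn
  obtain ⟨u, hu⟩ : ∃ u : S n, DifferentiableAt ℝ (suppExt K) (u : E n) := by
    have h : NeZero (surf n) := ⟨Measure.toSphere_ne_zero _⟩
    exact (ae_surf_differentiableAt hn (isHomLip_suppExt K)).exists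
  exact ⟨u, fun h => by have := norm_eq_of_mem_sphere u; rw [h, norm_zero] at this; norm_num at this, hu⟩

/-- In a unit direction of the ball the symmetric sum g of values of h_K has derivative 0 at ε = 0.
Subadditivity of h_M would force g to grow there at least linearly, to pay for the term t · 2r|ε|
with t < 0. -/
theorem not_suppExt_extrapolation {K M : ConvexBody (E n)} {v : E n}
    (hv : DifferentiableAt ℝ (suppExt K) v) (hp : 1 ≤ p) {i : E p →ₗᵢ[ℝ] E n}
    (hi : ∀ z, inner ℝ v (i z) = 0) {r : ℝ} (hr : 0 < r) {t : ℝ} (ht : t < 0)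
    (hM : ∀ x, suppExt M x = (1 - t) * suppExt K x + t * suppExt (embeddedBall i r hr.le) x) :
    False := by
  have := nontrivial_E hp
  obtain ⟨e, he⟩ : ∃ e : E p, ‖e‖ = 1 := exists_norm_eq (E p) zero_le_one
  set T := ContinuousLinearMap.adjoint i.toContinuousLinearMap with hT
  have hTv : T v = 0 := by
    refine ext_inner_right ℝ fun z => ?_
    rw [hT, ContinuousLinearMap.adjoint_inner_left, inner_zero_left]
    exact hi z
  have hTe : T (i e) = e := by
    refine ext_inner_right ℝ fun z => ?_
    rw [hT, ContinuousLinearMap.adjoint_inner_left]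
    exact i.inner_map_map e z
  have hB : ∀ ε : ℝ, suppExt (embeddedBall i r hr.le) (v + ε • i e) = r * |ε| := fun ε => by
    rw [suppExt_embeddedBall, ← hT, map_add, map_smul, hTv, hTe, zero_add, norm_smul, he, mul_one,
      Real.norm_eq_abs]
  set g : ℝ → ℝ := fun ε => suppExt K (v + ε • i e) + suppExt K (v + -ε • i e) with hg
  have hderiv : HasDerivAt g 0 0 := by
    have h1 : HasDerivAt (fun ε : ℝ => v + ε • i e) (i e) 0 := by
      simpa using ((hasDerivAt_id (0 : ℝ)).smul_const (i e)).const_add v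
    have h2 : HasDerivAt (fun ε : ℝ => v + -ε • i e) (-i e) 0 := by
      simpa using ((hasDerivAt_id (0 : ℝ)).neg.smul_const (i e)).const_add v
    have h3 := HasFDerivAt.comp_hasDerivAt (0 : ℝ) (by simpa using hv.hasFDerivAt) h1
    have h4 := HasFDerivAt.comp_hasDerivAt (0 : ℝ) (by simpa using hv.hasFDerivAt) h2
    have h5 := h3.add h4
    rw [map_neg, add_neg_cancel] at h5
    exact h5
  -- Subadditivity of h_M at v ± εe reads (1−t)(g(ε) − g(0)) ≥ −2trε.
  set c := -t * (2 * r) / (1 - t) with hc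
  have hc0 : 0 < c := div_pos (mul_pos (by linarith) (by linarith)) (by linarith)
  have hlow : ∀ ε : ℝ, 0 < ε → c * ε ≤ g ε - g 0 := by
    intro ε hε
    have h1 := suppExt_add_le M (v + ε • i e) (v + -ε • i e)
    -- The term with coefficient 0 lets `hB` evaluate the midpoint as well.
    rw [show v + ε • i e + (v + -ε • i e) = (2 : ℝ) • (v + (0 : ℝ) • i e) by module,
      suppExt_smul M 2 _ (by norm_num), hM, hM, hM, hB, hB, hB, abs_neg, abs_of_pos hε, abs_zero]
      at h1
    rw [hc, div_mul_eq_mul_div, div_le_iff₀ (by linarith), hg]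
    simp only [neg_zero]
    linarith
  have hslope := hderiv.tendsto_slope_zero_right
  have h2 : c ≤ 0 := by
    refine ge_of_tendsto hslope ?_
    filter_upwards [self_mem_nhdsWithin] with ε hε
    have hε' : (0 : ℝ) < ε := hε
    rw [zero_add, smul_eq_mul, inv_mul_eq_div, le_div_iff₀ hε']
    exact hlow ε hε'
  linarith

end EmbeddedBall

/-! ### Lorentzian geometry of the form: hyperbolic angles and geodesics. -/

section Lorentz

variable {n : ℕ} {f g h : E n → ℝ}

lemma IsHomLip.gaussForm_add_smul {f₁ f₂ g : E n → ℝ} (h₁ : IsHomLip f₁) (h₂ : IsHomLip f₂)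
    (hg : IsHomLip g) (a b : ℝ) :
    gaussForm (fun x => a * f₁ x + b * f₂ x) g = a * gaussForm f₁ g + b * gaussForm f₂ g := by
  obtain ⟨_, h₁⟩ := h₁.lipschitz
  obtain ⟨_, h₂⟩ := h₂.lipschitz
  obtain ⟨_, hg⟩ := hg.lipschitz
  exact AreaMetric.gaussForm_add_smul h₁ h₂ hg a b

lemma IsHomLip.gaussForm_add_smul_right {f₁ f₂ g : E n → ℝ} (h₁ : IsHomLip f₁)
    (h₂ : IsHomLip f₂) (hg : IsHomLip g) (a b : ℝ) :
    gaussForm g (fun x => a * f₁ x + b * f₂ x) = a * gaussForm g f₁ + b * gaussForm g f₂ := by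
  rw [gaussForm_comm, h₁.gaussForm_add_smul h₂ hg, gaussForm_comm g, gaussForm_comm g]

lemma IsHomLip.gaussForm_add_smul_self (hf : IsHomLip f) (hg : IsHomLip g) (a b : ℝ) :
    gaussForm (fun x => a * f x + b * g x) (fun x => a * f x + b * g x) =
      a ^ 2 * gaussForm f f + 2 * a * b * gaussForm f g + b ^ 2 * gaussForm g g := by
  rw [hf.gaussForm_add_smul hg (hf.add_smul hg a b), hf.gaussForm_add_smul_right hg hf,
    hf.gaussForm_add_smul_right hg hg, gaussForm_comm g f]
  ring

/-- Homogeneous functions that are normalized and on which the form is positive. -/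
structure IsTimelike (f : E n → ℝ) : Prop where
  hom : IsHomLip f
  normalized : IsNormalizedFun f
  pos : 0 < gaussForm f f

lemma IsNormalizedFun.integral_eq (hf : IsNormalizedFun f) (hg : IsNormalizedFun g) :
    ∫ x, f x ∂(stdGaussian (E n)) = ∫ x, g x ∂(stdGaussian (E n)) := by
  have h0 : (2 * π) ^ (1 / 2 : ℝ) ≠ 0 := by positivity
  exact mul_left_cancel₀ h0 (hf.2.trans hg.2.symm)

lemma IsHomLip.eq_zero_of_gaussForm_nonneg (hf : IsHomLip f)
    (h0 : ∫ x, f x ∂(stdGaussian (E n)) = 0)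
    (h1 : ∀ v : E n, ∫ x, inner ℝ v x * f x ∂(stdGaussian (E n)) = 0)
    (hQ : 0 ≤ gaussForm f f) (x : E n) : f x = 0 := by
  obtain ⟨C, hC⟩ := hf.lipschitz
  exact eq_zero_of_energy_le hC h0 h1 hQ x

/-- Normalization makes f − g of mean zero and uncorrelated with linear functions, and the
hypothesis says that the form is nonnegative on it. -/
lemma IsTimelike.sub_eq_zero (hf : IsTimelike f) (hg : IsTimelike g)
    (h : 2 * gaussForm f g ≤ gaussForm f f + gaussForm g g) (x : E n) : f x = g x := by
  have h1 : 1 * f x + (-1) * g x = 0 := by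
    refine IsHomLip.eq_zero_of_gaussForm_nonneg (f := fun x => 1 * f x + (-1) * g x)
      (hf.hom.add_smul hg.hom 1 (-1)) ?_ (fun v => ?_) ?_ x
    · rw [hf.hom.integral_add_smul hg.hom, hf.normalized.integral_eq hg.normalized]; ring
    · rw [hf.hom.integral_inner_add_smul hg.hom, hf.normalized.1, hg.normalized.1]; ring
    · rw [hf.hom.gaussForm_add_smul_self hg.hom]; linarith
  linarith

/-- If it failed, f and g would coincide by `IsTimelike.sub_eq_zero`, and then equality holds.
Together with the arithmetic-geometric mean inequality this is the reversed Cauchy–Schwarz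
inequality. -/
lemma IsTimelike.add_le (hf : IsTimelike f) (hg : IsTimelike g) :
    gaussForm f f + gaussForm g g ≤ 2 * gaussForm f g := by
  by_contra! hlt
  have e : f = g := funext (hf.sub_eq_zero hg hlt.le)
  rw [e] at hlt
  linarith

lemma IsTimelike.sqrt_mul_le (hf : IsTimelike f) (hg : IsTimelike g) :
    √(gaussForm f f * gaussForm g g) ≤ gaussForm f g := by
  have h1 := hf.add_le hg
  have h2 := hf.pos
  have h3 := hg.pos
  refine Real.sqrt_le_iff.2 ⟨by linarith, ?_⟩
  nlinarith [sq_nonneg (gaussForm f f - gaussForm g g)]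

/-- The hyperbolic angle of two functions with respect to the Gaussian form. -/
noncomputable def hypAngle (f g : E n → ℝ) : ℝ :=
  Real.arcosh (gaussForm f g / √(gaussForm f f * gaussForm g g))

lemma IsTimelike.one_le_ratio (hf : IsTimelike f) (hg : IsTimelike g) :
    1 ≤ gaussForm f g / √(gaussForm f f * gaussForm g g) := by
  rw [one_le_div (Real.sqrt_pos.2 (mul_pos hf.pos hg.pos))]
  exact hf.sqrt_mul_le hg

lemma hypAngle_comm (f g : E n → ℝ) : hypAngle f g = hypAngle g f := by
  rw [hypAngle, hypAngle, gaussForm_comm f g, mul_comm]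

lemma IsTimelike.gaussForm_eq (hf : IsTimelike f) (hg : IsTimelike g) :
    gaussForm f g = √(gaussForm f f) * √(gaussForm g g) * cosh (hypAngle f g) := by
  rw [hypAngle, cosh_arcosh (hf.one_le_ratio hg), ← Real.sqrt_mul hf.pos.le, mul_div_cancel₀]
  exact (Real.sqrt_pos.2 (mul_pos hf.pos hg.pos)).ne'

lemma IsTimelike.hypAngle_nonneg (hf : IsTimelike f) (hg : IsTimelike g) : 0 ≤ hypAngle f g :=
  arcosh_nonneg (hf.one_le_ratio hg)

lemma IsTimelike.eq_of_hypAngle_eq_zero (hf : IsTimelike f) (hg : IsTimelike g)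
    (h : hypAngle f g = 0) (x : E n) : f x = g x := by
  refine hf.sub_eq_zero hg ?_ x
  rw [hf.gaussForm_eq hg, h, cosh_zero]
  nlinarith [sq_nonneg (√(gaussForm f f) - √(gaussForm g g)), Real.sq_sqrt hf.pos.le,
    Real.sq_sqrt hg.pos.le]

lemma hypAngle_self (hf : IsTimelike f) : hypAngle f f = 0 := by
  rw [hypAngle, Real.sqrt_mul_self hf.pos.le, div_self hf.pos.ne', arcosh_zero]

/-- A, X, C stand for the Gram entries of two timelike vectors, and B for the square of their
combination. The Gram determinants of the two sub-pairs are τ²Δ and (1−τ)²Δ up to sign, which gives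
the hyperbolic sines; the addition formula for cosh concludes. -/
lemma arcosh_lorentz_add {A X C τ : ℝ} (hA : 0 < A) (hC : 0 < C) (hX : √(A * C) ≤ X)
    (h0 : 0 ≤ τ) (h1 : τ ≤ 1) :
    arcosh (X / √(A * C)) =
      arcosh (((1 - τ) * A + τ * X) /
        √(A * ((1 - τ) ^ 2 * A + 2 * (1 - τ) * τ * X + τ ^ 2 * C))) +
      arcosh (((1 - τ) * X + τ * C) /
        √(((1 - τ) ^ 2 * A + 2 * (1 - τ) * τ * X + τ ^ 2 * C) * C)) := by
  set B := (1 - τ) ^ 2 * A + 2 * (1 - τ) * τ * X + τ ^ 2 * C with hB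
  have h1' : 0 ≤ 1 - τ := by linarith
  have hAC : 0 < A * C := mul_pos hA hC
  have hXpos : 0 < X := (Real.sqrt_pos.2 hAC).trans_le hX
  have hX2 : A * C ≤ X ^ 2 := (Real.sqrt_le_left hXpos.le).1 hX
  have hBpos : 0 < B := by
    rcases eq_or_lt_of_le h0 with h | h
    · rw [hB, ← h]; simpa using hA
    · have : 0 < τ ^ 2 * C := by positivity
      have : 0 ≤ (1 - τ) ^ 2 * A := by positivity
      have : 0 ≤ 2 * (1 - τ) * τ * X := by positivity
      linarith
  set Δ := X ^ 2 - A * C with hΔ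
  have hΔ0 : 0 ≤ Δ := by linarith
  have e1 : ((1 - τ) * A + τ * X) ^ 2 = A * B + τ ^ 2 * Δ := by rw [hB, hΔ]; ring
  have e2 : ((1 - τ) * X + τ * C) ^ 2 = B * C + (1 - τ) ^ 2 * Δ := by rw [hB, hΔ]; ring
  have hAB : 0 < A * B := mul_pos hA hBpos
  have hBC : 0 < B * C := mul_pos hBpos hC
  have hP : 0 ≤ (1 - τ) * A + τ * X := by positivity
  have hR : 0 ≤ (1 - τ) * X + τ * C := by positivity
  have k1 : 1 ≤ ((1 - τ) * A + τ * X) / √(A * B) := by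
    rw [one_le_div (Real.sqrt_pos.2 hAB)]
    refine Real.sqrt_le_iff.2 ⟨hP, ?_⟩
    rw [e1]
    have : 0 ≤ τ ^ 2 * Δ := by positivity
    linarith
  have k2 : 1 ≤ ((1 - τ) * X + τ * C) / √(B * C) := by
    rw [one_le_div (Real.sqrt_pos.2 hBC)]
    refine Real.sqrt_le_iff.2 ⟨hR, ?_⟩
    rw [e2]
    have : 0 ≤ (1 - τ) ^ 2 * Δ := by positivity
    linarith
  have s1 : sinh (arcosh (((1 - τ) * A + τ * X) / √(A * B))) = τ * √Δ / √(A * B) := by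
    rw [sinh_arcosh k1, div_pow, Real.sq_sqrt hAB.le, e1, add_div, div_self hAB.ne',
      add_sub_cancel_left, Real.sqrt_div (by positivity), Real.sqrt_mul (by positivity),
      Real.sqrt_sq h0]
  have s2 : sinh (arcosh (((1 - τ) * X + τ * C) / √(B * C))) = (1 - τ) * √Δ / √(B * C) := by
    rw [sinh_arcosh k2, div_pow, Real.sq_sqrt hBC.le, e2, add_div, div_self hBC.ne',
      add_sub_cancel_left, Real.sqrt_div (by positivity), Real.sqrt_mul (by positivity),
      Real.sqrt_sq h1']
  rw [← arcosh_cosh (add_nonneg (arcosh_nonneg k1) (arcosh_nonneg k2)), cosh_add, s1, s2,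
    cosh_arcosh k1, cosh_arcosh k2]
  congr 1
  rw [div_mul_div_comm, div_mul_div_comm, ← add_div, Real.sqrt_mul hA.le, Real.sqrt_mul hA.le,
    Real.sqrt_mul hBpos.le]
  have a0 : √A ≠ 0 := (Real.sqrt_pos.2 hA).ne'
  have c0 : √C ≠ 0 := (Real.sqrt_pos.2 hC).ne'
  have b0 : √B ≠ 0 := (Real.sqrt_pos.2 hBpos).ne'
  rw [div_eq_div_iff (by positivity) (by positivity)]
  have hb : √B * √B = B := Real.mul_self_sqrt hBpos.le
  have hd : √Δ * √Δ = Δ := Real.mul_self_sqrt hΔ0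
  calc X * (√A * √B * (√B * √C)) = X * B * (√A * √C) := by
        linear_combination X * √A * √C * hb
    _ = (((1 - τ) * A + τ * X) * ((1 - τ) * X + τ * C) + τ * (1 - τ) * Δ) * (√A * √C) := by
        rw [hB, hΔ]; ring
    _ = _ := by linear_combination (-(τ * (1 - τ) * √A * √C)) * hd

lemma IsTimelike.hypAngle_add (hf : IsTimelike f) (hg : IsTimelike g) {τ : ℝ} (h0 : 0 ≤ τ)
    (h1 : τ ≤ 1) :
    hypAngle f g = hypAngle f (fun x => (1 - τ) * f x + τ * g x) +
      hypAngle (fun x => (1 - τ) * f x + τ * g x) g := by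
  have h := arcosh_lorentz_add hf.pos hg.pos (hf.sqrt_mul_le hg) h0 h1
  simp only [hypAngle]
  rw [h, hf.hom.gaussForm_add_smul_self hg.hom, hf.hom.gaussForm_add_smul_right hg.hom hf.hom,
    hf.hom.gaussForm_add_smul hg.hom hg.hom]

/-- In a hyperbolic plane with additive angles, k₁f + k₂h = k₃g for the sine-rule coefficients
below. Here the combination is first known only to be null and orthogonal to f. Correcting its
f-coefficient to make the mean zero gives a function on which the form is a square, hence the zero
function. -/
theorem IsTimelike.exists_between (hf : IsTimelike f) (hg : IsTimelike g) (hh : IsTimelike h)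
    (h1 : 0 < hypAngle f g) (h2 : 0 < hypAngle g h)
    (h3 : hypAngle f h = hypAngle f g + hypAngle g h) :
    ∃ τ : ℝ, 0 < τ ∧ τ < 1 ∧ ∀ x, g x = (1 - τ) * f x + τ * h x := by
  set α := hypAngle f g
  set β := hypAngle g h
  have qfg := hf.gaussForm_eq hg
  have qgh := hg.gaussForm_eq hh
  have qfh := hf.gaussForm_eq hh
  rw [h3] at qfh
  have qff := Real.sq_sqrt hf.pos.le
  have qgg := Real.sq_sqrt hg.pos.le
  have qhh := Real.sq_sqrt hh.pos.le
  have a0 := Real.sqrt_pos.2 hf.pos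
  have b0 := Real.sqrt_pos.2 hg.pos
  have c0 := Real.sqrt_pos.2 hh.pos
  set a := √(gaussForm f f)
  set b := √(gaussForm g g)
  set c := √(gaussForm h h)
  have sα := Real.sinh_pos_iff.2 h1
  have sβ := Real.sinh_pos_iff.2 h2
  have sαβ := Real.sinh_pos_iff.2 (add_pos h1 h2)
  obtain ⟨k₁, hk₁⟩ : ∃ k, k = sinh β / a := ⟨_, rfl⟩
  obtain ⟨k₂, hk₂⟩ : ∃ k, k = sinh α / c := ⟨_, rfl⟩
  obtain ⟨k₃, hk₃⟩ : ∃ k, k = sinh (α + β) / b := ⟨_, rfl⟩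
  have p₁ : 0 < k₁ := hk₁ ▸ div_pos sβ a0
  have p₂ : 0 < k₂ := hk₂ ▸ div_pos sα c0
  have p₃ : 0 < k₃ := hk₃ ▸ div_pos sαβ b0
  have m₁ : k₁ * a = sinh β := by rw [hk₁, div_mul_cancel₀ _ a0.ne']
  have m₂ : k₂ * c = sinh α := by rw [hk₂, div_mul_cancel₀ _ c0.ne']
  have m₃ : k₃ * b = sinh (α + β) := by rw [hk₃, div_mul_cancel₀ _ b0.ne']
  -- The coefficient k₃ − k₂ replaces k₁, so that u − k₃g has mean zero; k₁ + k₂ = k₃ follows at the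
  -- end.
  set u : E n → ℝ := fun x => (k₃ - k₂) * f x + k₂ * h x with hu
  have hul : IsHomLip u := hf.hom.add_smul hh.hom _ _
  have hwl : IsHomLip fun x => 1 * u x + (-k₃) * g x := hul.add_smul hg.hom _ _
  have hq : gaussForm (fun x => 1 * u x + (-k₃) * g x) (fun x => 1 * u x + (-k₃) * g x) =
      ((k₁ + k₂ - k₃) * a) ^ 2 := by
    rw [hul.gaussForm_add_smul_self hg.hom, hf.hom.gaussForm_add_smul_self hh.hom,
      hf.hom.gaussForm_add_smul hh.hom hg.hom, gaussForm_comm h g, qfg, qgh, qfh, ← qff, ← qgg,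
      ← qhh]
    have hsα := Real.cosh_sq α
    have hsβ := Real.cosh_sq β
    -- `i0`: k₁f + k₂h − k₃g is null; `i1`: it is orthogonal to f.
    have i0 : sinh β ^ 2 + sinh α ^ 2 + sinh (α + β) ^ 2 + 2 * sinh β * sinh α * cosh (α + β) -
        2 * sinh β * sinh (α + β) * cosh α - 2 * sinh α * sinh (α + β) * cosh β = 0 := by
      rw [sinh_add, cosh_add]
      linear_combination (-(sinh β ^ 2)) * hsα + (-(sinh α ^ 2)) * hsβ
    have i1 : sinh β + sinh α * cosh (α + β) - sinh (α + β) * cosh α = 0 := by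
      rw [sinh_add, cosh_add]
      linear_combination (-(sinh β)) * hsα
    rw [← m₁, ← m₂, ← m₃] at i0 i1
    linear_combination i0 - 2 * (k₁ + k₂ - k₃) * a * i1
  have hzero : ∀ x, 1 * u x + (-k₃) * g x = 0 := by
    refine hwl.eq_zero_of_gaussForm_nonneg ?_ (fun v => ?_) ?_
    · rw [hul.integral_add_smul hg.hom, hf.hom.integral_add_smul hh.hom,
        hf.normalized.integral_eq hg.normalized, hh.normalized.integral_eq hg.normalized]
      ring
    · rw [hul.integral_inner_add_smul hg.hom, hf.hom.integral_inner_add_smul hh.hom,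
        hf.normalized.1, hg.normalized.1, hh.normalized.1]
      ring
    · rw [hq]; positivity
  have hz : gaussForm (fun x => 1 * u x + (-k₃) * g x) (fun x => 1 * u x + (-k₃) * g x) = 0 := by
    have : (fun x => 1 * u x + (-k₃) * g x) = fun _ => 0 := funext hzero
    rw [this, gaussForm]
    have e : ∀ x : E n, gradient (fun _ : E n => (0 : ℝ)) x = 0 := fun x => gradient_fun_const x 0
    simp [e]
  rw [hq, sq_eq_zero_iff, mul_eq_zero, or_iff_left a0.ne'] at hz
  refine ⟨k₂ / k₃, div_pos p₂ p₃, (div_lt_one p₃).2 (by linarith), fun x => ?_⟩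
  have h4 := hzero x
  simp only [hu] at h4
  field_simp
  linarith

end Lorentz

/-! ### Shortest paths for the area metric. -/

section Paths

variable {n : ℕ}

lemma NormBody.isTimelike (hn : 1 ≤ n) (K : NormBody n) : IsTimelike (suppExt K.1) :=
  ⟨isHomLip_suppExt K.1, (isNormalized_iff hn K.1).1 K.2.1,
    gaussForm_suppExt_pos (hasTriangle_of_not_isPointOrSegment K.2.2)⟩

theorem areaDist_eq_hypAngle (hn : 2 ≤ n) (K L : NormBody n) :
    areaDist K L = hypAngle (suppExt K.1) (suppExt L.1) := by
  have hc : 0 < (2 * kappa (n - 2) * radialMoment n 0)⁻¹ := by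
    have := kappa_pos (n - 2)
    have := radialMoment_pos n 0 (by omega : 1 ≤ n)
    positivity
  have e : ∀ M N : ConvexBody (E n), V2 n (supp M) (supp N) =
      (2 * kappa (n - 2) * radialMoment n 0)⁻¹ * gaussForm (suppExt M) (suppExt N) :=
    fun M N => V2_eq_gaussForm hn (isHomLip_suppExt M) (isHomLip_suppExt N)
  rw [areaDist, hypAngle, e, e, e, mul_mul_mul_comm, Real.sqrt_mul (by positivity),
    Real.sqrt_mul_self hc.le, mul_div_mul_left _ _ hc.ne']

/-- The distance from m 0 is a monotone continuous parameter. The intermediate value theorem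
provides a right inverse of it, which gives the arc length parametrization, run from m s to m 0. -/
lemma isShortestPath_of_additive {X : Type*} {d : X → X → ℝ} {s : ℝ} (hs : 0 ≤ s) (m : ℝ → X)
    (hself : ∀ r ∈ Set.Icc 0 s, d (m r) (m r) = 0)
    (hcomm : ∀ x y, d x y = d y x)
    (hadd : ∀ r₁ r₂ r₃, 0 ≤ r₁ → r₁ ≤ r₂ → r₂ ≤ r₃ → r₃ ≤ s →
      d (m r₁) (m r₃) = d (m r₁) (m r₂) + d (m r₂) (m r₃))
    (hnonneg : ∀ r ∈ Set.Icc 0 s, ∀ r' ∈ Set.Icc 0 s, 0 ≤ d (m r) (m r'))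
    (hzero : ∀ r ∈ Set.Icc 0 s, ∀ r' ∈ Set.Icc 0 s, d (m r) (m r') = 0 → m r = m r')
    (hcont : ContinuousOn (fun r => d (m 0) (m r)) (Set.Icc 0 s)) :
    IsShortestPath d (m '' Set.Icc 0 s) (m s) (m 0) := by
  have h0 : (0 : ℝ) ∈ Set.Icc 0 s := ⟨le_rfl, hs⟩
  have h1 : s ∈ Set.Icc 0 s := ⟨hs, le_rfl⟩
  set D : ℝ → ℝ := fun r => d (m 0) (m r) with hD
  have hD0 : D 0 = 0 := hself 0 h0
  have habs : ∀ r ∈ Set.Icc 0 s, ∀ r' ∈ Set.Icc 0 s, d (m r) (m r') = |D r - D r'| := by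
    have aux : ∀ r r', 0 ≤ r → r ≤ r' → r' ≤ s → d (m r) (m r') = |D r - D r'| := by
      intro r r' hr hrr hr'
      have e := hadd 0 r r' le_rfl hr hrr hr'
      have := hnonneg r ⟨hr, hrr.trans hr'⟩ r' ⟨hr.trans hrr, hr'⟩
      have e' : D r' = D r + d (m r) (m r') := e
      rw [e', abs_sub_comm, add_sub_cancel_left, abs_of_nonneg this]
    intro r hr r' hr'
    rcases le_total r r' with h | h
    · exact aux r r' hr.1 h hr'.2
    · rw [hcomm, abs_sub_comm]; exact aux r' r hr'.1 h hr.2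
  have hmono : ∀ r ∈ Set.Icc 0 s, D r ≤ D s := by
    intro r hr
    have e : D s = D r + d (m r) (m s) := hadd 0 r s le_rfl hr.1 hr.2 le_rfl
    linarith [hnonneg r hr s h1]
  have hsurj : ∀ t ∈ Set.Icc 0 (D s), ∃ r ∈ Set.Icc 0 s, D r = D s - t := by
    intro t ht
    have h := intermediate_value_Icc hs hcont
    rw [hD0] at h
    exact h ⟨by linarith [ht.2], by linarith [ht.1]⟩
  choose! ρ hρ hρD using hsurj
  have hl : 0 ≤ D s := hnonneg 0 h0 s h1
  have heq : ∀ r ∈ Set.Icc 0 s, ∀ r' ∈ Set.Icc 0 s, D r = D r' → m r = m r' := by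
    intro r hr r' hr' h
    refine hzero r hr r' hr' ?_
    rw [habs r hr r' hr', h, sub_self, abs_zero]
  have hl0 : (0 : ℝ) ∈ Set.Icc 0 (D s) := ⟨le_rfl, hl⟩
  have hl1 : D s ∈ Set.Icc 0 (D s) := ⟨hl, le_rfl⟩
  refine ⟨D s, fun t => m (ρ t), hl, fun t ht t' ht' => ?_, ?_, ?_, ?_⟩
  · rw [habs _ (hρ t ht) _ (hρ t' ht'), hρD t ht, hρD t' ht', sub_sub_sub_cancel_left,
      abs_sub_comm]
  · exact heq _ (hρ 0 hl0) _ h1 (by rw [hρD 0 hl0, sub_zero])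
  · exact heq _ (hρ _ hl1) _ h0 (by rw [hρD _ hl1, sub_self, hD0])
  · ext x
    constructor
    · rintro ⟨t, ht, rfl⟩
      exact ⟨ρ t, hρ t ht, rfl⟩
    · rintro ⟨r, hr, rfl⟩
      have hDr : D r ∈ Set.Icc 0 (D s) := ⟨hnonneg 0 h0 r hr, hmono r hr⟩
      have ht : D s - D r ∈ Set.Icc 0 (D s) := ⟨by linarith [hDr.2], by linarith [hDr.1]⟩
      exact ⟨D s - D r, ht, heq _ (hρ _ ht) _ hr (by rw [hρD _ ht, sub_sub_cancel])⟩

lemma comb_zero (K B : ConvexBody (E n)) : comb K B 0 = K := by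
  apply SetLike.coe_injective
  rw [comb, sub_zero, ConvexBody.coe_add, ConvexBody.coe_smul, ConvexBody.coe_smul, one_smul,
    Set.zero_smul_set B.nonempty, add_zero]

theorem isShortestPath_comb (hn : 2 ≤ n) (K : NormBody n) {B : ConvexBody (E n)}
    (hB : IsNormalized B)
    (hterm : ∀ t : ℝ, t < 0 → ¬ ∃ M : ConvexBody (E n),
      ∀ u : S n, supp M u = (1 - t) * supp K.1 u + t * supp B u)
    {s : ℝ} (hs : s ∈ Set.Ioc (0 : ℝ) 1) {L : NormBody n} (hL : L.1 = comb K.1 B s) :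
    IsShortestPath areaDist {M : NormBody n | ∃ r ∈ Set.Icc 0 s, M.1 = comb K.1 B r} L K := by
  classical
  have hn1 : 1 ≤ n := by omega
  have hsub : ∀ r ∈ Set.Icc 0 s, r ∈ Set.Icc (0 : ℝ) 1 := fun r hr => ⟨hr.1, hr.2.trans hs.2⟩
  have hmem : ∀ r ∈ Set.Icc 0 s,
      IsNormalized (comb K.1 B r) ∧ ¬ IsPointOrSegment (comb K.1 B r) := by
    intro r hr
    refine ⟨isNormalized_comb hn1 K.2.1 hB (hsub r hr), ?_⟩
    -- At r = s non-degeneracy comes from L, since for s = 1 the ball contributes alone and may be a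
    -- segment.
    rcases eq_or_lt_of_le hr.2 with h | h
    · rw [h, ← hL]; exact L.2.2
    · exact ((hasTriangle_of_not_isPointOrSegment K.2.2).comb_left
        (by linarith [hs.2])).not_isPointOrSegment
  set m : ℝ → NormBody n := fun r => if h : r ∈ Set.Icc 0 s then ⟨comb K.1 B r, hmem r h⟩ else K
  have hmv : ∀ r ∈ Set.Icc 0 s, (m r).1 = comb K.1 B r := fun r hr =>
    congrArg Subtype.val (dif_pos hr : m r = ⟨comb K.1 B r, hmem r hr⟩)
  have h0 : (0 : ℝ) ∈ Set.Icc 0 s := ⟨le_rfl, hs.1.le⟩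
  have h1 : s ∈ Set.Icc 0 s := ⟨hs.1.le, le_rfl⟩
  have hm0 : m 0 = K := Subtype.ext ((hmv 0 h0).trans (comb_zero _ _))
  have hms : m s = L := Subtype.ext ((hmv s h1).trans hL.symm)
  have hP : {M : NormBody n | ∃ r ∈ Set.Icc 0 s, M.1 = comb K.1 B r} = m '' Set.Icc 0 s := by
    ext M
    constructor
    · rintro ⟨r, hr, h⟩
      exact ⟨r, hr, Subtype.ext ((hmv r hr).trans h.symm)⟩
    · rintro ⟨r, hr, rfl⟩
      exact ⟨r, hr, hmv r hr⟩
  have hsupp : ∀ r ∈ Set.Icc 0 s, suppExt (m r).1 =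
      fun x => (1 - r) * suppExt K.1 x + r * suppExt B x := fun r hr => by
    rw [hmv r hr, suppExt_comb_fun _ _ (hsub r hr)]
  have hT := NormBody.isTimelike (n := n) hn1
  have hBl := isHomLip_suppExt B
  rw [hP, ← hms]
  suffices h : IsShortestPath areaDist (m '' Set.Icc 0 s) (m s) (m 0) by rwa [hm0] at h
  refine isShortestPath_of_additive hs.1.le m (fun r _ => ?_) (fun x y => ?_) ?_ (fun r _ r' _ => ?_)
    (fun r hr r' hr' h => ?_) ?_
  · rw [areaDist_eq_hypAngle hn, hypAngle_self (hT _)]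
  · rw [areaDist_eq_hypAngle hn, areaDist_eq_hypAngle hn, hypAngle_comm]
  · intro r₁ r₂ r₃ a1 a2 a3 a4
    rw [areaDist_eq_hypAngle hn, areaDist_eq_hypAngle hn, areaDist_eq_hypAngle hn]
    obtain ⟨τ, t0, t1, ht⟩ : ∃ τ : ℝ, 0 ≤ τ ∧ τ ≤ 1 ∧ r₂ = (1 - τ) * r₁ + τ * r₃ := by
      rcases eq_or_lt_of_le (a2.trans a3) with h | h
      · exact ⟨0, le_rfl, zero_le_one, by linarith⟩
      · have h' : 0 < r₃ - r₁ := sub_pos.2 h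
        refine ⟨(r₂ - r₁) / (r₃ - r₁), div_nonneg (by linarith) h'.le, ?_, ?_⟩
        · rw [div_le_one h']; linarith
        · field_simp; ring
    have e : suppExt (m r₂).1 = fun x => (1 - τ) * suppExt (m r₁).1 x + τ * suppExt (m r₃).1 x := by
      rw [hsupp r₁ ⟨a1, by linarith⟩, hsupp r₂ ⟨by linarith, by linarith⟩,
        hsupp r₃ ⟨by linarith, a4⟩]
      ext x
      rw [ht]
      ring
    rw [e]
    exact (hT _).hypAngle_add (hT _) t0 t1
  · rw [areaDist_eq_hypAngle hn]
    exact (hT _).hypAngle_nonneg (hT _)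
  · rw [areaDist_eq_hypAngle hn] at h
    have hx := (hT _).eq_of_hypAngle_eq_zero (hT _) h
    suffices r = r' by rw [this]
    by_contra hne
    -- If K and B had equal support functions, K itself would be the extrapolation 2K − B, which is
    -- excluded.
    refine hterm (-1) (by norm_num) ⟨K.1, fun u => ?_⟩
    have h2 := hx u
    rw [hsupp r hr, hsupp r' hr'] at h2
    have h3 : (r - r') * (suppExt K.1 u - suppExt B u) = 0 := by linear_combination -h2
    rcases mul_eq_zero.1 h3 with h4 | h4
    · exact absurd (sub_eq_zero.1 h4) hne
    · rw [supp_eq_suppExt, supp_eq_suppExt]; linarith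
  · have hK := hT K
    have e : ∀ r ∈ Set.Icc 0 s, areaDist (m 0) (m r) =
        arcosh (((1 - r) * gaussForm (suppExt K.1) (suppExt K.1) +
          r * gaussForm (suppExt K.1) (suppExt B)) /
          √(gaussForm (suppExt K.1) (suppExt K.1) *
            ((1 - r) ^ 2 * gaussForm (suppExt K.1) (suppExt K.1) +
            2 * (1 - r) * r * gaussForm (suppExt K.1) (suppExt B) +
            r ^ 2 * gaussForm (suppExt B) (suppExt B)))) := by
      intro r hr
      rw [areaDist_eq_hypAngle hn, hm0, hypAngle, hsupp r hr, hK.hom.gaussForm_add_smul_self hBl,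
        hK.hom.gaussForm_add_smul_right hBl hK.hom]
    have hpos : ∀ r ∈ Set.Icc 0 s, 0 < (1 - r) ^ 2 * gaussForm (suppExt K.1) (suppExt K.1) +
            2 * (1 - r) * r * gaussForm (suppExt K.1) (suppExt B) +
            r ^ 2 * gaussForm (suppExt B) (suppExt B) := by
      intro r hr
      have := (hT (m r)).pos
      rwa [hsupp r hr, hK.hom.gaussForm_add_smul_self hBl] at this
    refine ContinuousOn.congr ?_ e
    refine continuousOn_arcosh.comp (ContinuousOn.div (by fun_prop) (by fun_prop) fun r hr => ?_)
      fun r hr => ?_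
    · exact (Real.sqrt_pos.2 (mul_pos hK.pos (hpos r hr))).ne'
    · have := hK.one_le_ratio (hT (m r))
      rwa [hsupp r hr, hK.hom.gaussForm_add_smul_self hBl,
        hK.hom.gaussForm_add_smul_right hBl hK.hom] at this

theorem notExtendableBeyond_comb (hn : 2 ≤ n) (K : NormBody n) {B : ConvexBody (E n)}
    (hterm : ∀ t : ℝ, t < 0 → ¬ ∃ M : ConvexBody (E n),
      ∀ u : S n, supp M u = (1 - t) * supp K.1 u + t * supp B u)
    {s : ℝ} (hs : s ∈ Set.Ioc (0 : ℝ) 1) {L : NormBody n} (hL : L.1 = comb K.1 B s) :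
    NotExtendableBeyond areaDist
      {M : NormBody n | ∃ r ∈ Set.Icc 0 s, M.1 = comb K.1 B r} K := by
  have hT := NormBody.isTimelike (n := n) (by omega)
  have hLs := suppExt_comb K.1 B (s := s) ⟨hs.1.le, hs.2⟩
  rw [← hL] at hLs
  have key : ∀ M : NormBody n, 0 < areaDist L K → 0 < areaDist K M →
      areaDist L M ≠ areaDist L K + areaDist K M := by
    intro M h1 h2 h3
    rw [areaDist_eq_hypAngle hn] at h1 h2
    rw [areaDist_eq_hypAngle hn, areaDist_eq_hypAngle hn, areaDist_eq_hypAngle hn] at h3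
    obtain ⟨τ, t0, t1, ht⟩ := (hT L).exists_between (hT K) (hT M) h1 h2 h3
    -- Solve K = (1−τ)L + τM with L = (1−s)K + sB for M; this is the resulting coefficient of B.
    refine hterm (-((1 - τ) * s / τ)) (neg_neg_of_pos (div_pos (mul_pos (by linarith) hs.1) t0))
      ⟨M.1, fun u => ?_⟩
    have h4 := ht u
    rw [hLs] at h4
    rw [supp_eq_suppExt, supp_eq_suppExt, supp_eq_suppExt]
    field_simp
    linear_combination -h4
  have hKP : K ∈ {M : NormBody n | ∃ r ∈ Set.Icc 0 s, M.1 = comb K.1 B r} :=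
    ⟨0, ⟨le_rfl, hs.1.le⟩, (comb_zero _ _).symm⟩
  have hLP : L ∈ {M : NormBody n | ∃ r ∈ Set.Icc 0 s, M.1 = comb K.1 B r} :=
    ⟨s, ⟨hs.1.le, le_rfl⟩, hL⟩
  have hne : L ≠ K := by
    intro h
    refine hterm (-1) (by norm_num) ⟨K.1, fun u => ?_⟩
    have h4 := hLs u
    rw [h] at h4
    have h5 : s * (suppExt K.1 u - suppExt B u) = 0 := by linear_combination h4
    rw [mul_eq_zero, or_iff_right hs.1.ne'] at h5
    rw [supp_eq_suppExt, supp_eq_suppExt]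
    linarith
  rintro Q x y ⟨l, c, hl, hc, hx, hy, hcQ⟩ hPQ
  obtain ⟨t₀, ht₀, e₀⟩ := hcQ ▸ hPQ hKP
  obtain ⟨t₁, ht₁, e₁⟩ := hcQ ▸ hPQ hLP
  by_contra! hxy
  have n0 : t₀ ≠ 0 := fun h => hxy.1 (by rw [← hx, ← h, e₀])
  have nl : t₀ ≠ l := fun h => hxy.2 (by rw [← hy, ← h, e₀])
  have p0 : 0 < t₀ := lt_of_le_of_ne ht₀.1 n0.symm
  have pl : t₀ < l := lt_of_le_of_ne ht₀.2 nl
  have h01 : t₁ ≠ t₀ := fun h => hne (by rw [← e₁, h, e₀])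
  have hLK := hc t₁ ht₁ t₀ ht₀
  rw [e₀, e₁] at hLK
  -- If K is interior to the path, the endpoint on the side of K away from L serves as the forbidden
  -- M.
  rcases lt_or_gt_of_ne h01 with h | h
  · have d1 := hc t₀ ht₀ l ⟨hl, le_rfl⟩
    have d2 := hc t₁ ht₁ l ⟨hl, le_rfl⟩
    rw [abs_of_neg (by linarith)] at hLK d1 d2
    rw [e₀] at d1
    rw [e₁] at d2
    exact key (c l) (by linarith) (by linarith) (by linarith)
  · have d1 := hc t₀ ht₀ 0 ⟨le_rfl, hl⟩
    have d2 := hc t₁ ht₁ 0 ⟨le_rfl, hl⟩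
    rw [abs_of_pos (by linarith)] at hLK d1 d2
    rw [e₀] at d1
    rw [e₁] at d2
    exact key (c 0) (by linarith) (by linarith) (by linarith)

end Paths

end AreaMetric

end

open AreaMetric
theorem mainTheorem5 (n p : ℕ) (hp : 1 ≤ p) (hpn : p < n) (K : NormBody n) :
    ∃ B : ConvexBody (E n), IsEmbeddedBall p B ∧
      -- the segment consists of normalized bodies, not points or segments (apart from `B` if `p = 1`)
      (∀ s ∈ Set.Icc (0 : ℝ) 1, IsNormalized (comb K.1 B s) ∧
        ((s < 1 ∨ 2 ≤ p) → ¬ IsPointOrSegment (comb K.1 B s))) ∧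
      -- `K` is its terminal point
      IsTerminalPoint K.1 B ∧
      -- beyond `K` there is not even the support function of a convex body
      (∀ t : ℝ, t < 0 → ¬ ∃ M : ConvexBody (E n),
        ∀ u : S n, supp M u = (1 - t) * supp K.1 u + t * supp B u) ∧
      -- the part of the segment from any of its other points to `K` is a shortest path for the
      -- area metric, not extendable beyond `K`
      (∀ s ∈ Set.Ioc (0 : ℝ) 1, ∀ L : NormBody n, L.1 = comb K.1 B s →
        IsShortestPath areaDist {M : NormBody n | ∃ r ∈ Set.Icc 0 s, M.1 = comb K.1 B r} L K ∧
        NotExtendableBeyond areaDist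
          {M : NormBody n | ∃ r ∈ Set.Icc 0 s, M.1 = comb K.1 B r} K) := by
  have hn : 2 ≤ n := by omega
  have hn1 : 1 ≤ n := by omega
  obtain ⟨v, hv0, hv⟩ := exists_differentiableAt_suppExt hn1 K.1
  obtain ⟨i, hi⟩ := exists_isometry_orthogonal hpn v hv0
  set B := embeddedBall i (ballRadius p) (ballRadius_pos hp).le with hB
  have hBn : IsNormalized B := isNormalized_embeddedBall hp hn1 i
  have hterm : ∀ t : ℝ, t < 0 → ¬ ∃ M : ConvexBody (E n),
      ∀ u : S n, supp M u = (1 - t) * supp K.1 u + t * supp B u := by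
    rintro t ht ⟨M, hM⟩
    exact not_suppExt_extrapolation hv hp hi (ballRadius_pos hp) ht
      ((isHomLip_suppExt M).eq_of_eqOn_sphere
        ((isHomLip_suppExt K.1).add_smul (isHomLip_suppExt B) (1 - t) t) hM)
  refine ⟨B, ⟨i, rfl⟩, fun s hs => ⟨isNormalized_comb hn1 K.2.1 hBn hs, fun h => ?_⟩,
    fun t ht ⟨M, _, hM⟩ => hterm t ht ⟨M, hM⟩, hterm, fun s hs L hL =>
    ⟨isShortestPath_comb hn K hBn hterm hs hL, notExtendableBeyond_comb hn K hterm hs hL⟩⟩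
  by_cases h1 : s = 1
  · subst h1
    have hp2 : 2 ≤ p := h.resolve_left (lt_irrefl _)
    exact (hasTriangle_embeddedBall hp2 i (ballRadius_pos hp)).comb_right.not_isPointOrSegment
  · exact ((hasTriangle_of_not_isPointOrSegment K.2.2).comb_left h1).not_isPointOrSegment
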